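/- Let $X$ be a compact special cube complex, i.e. a cube complex with finitely many cubes in which the link of every vertex is a flag simplicial complex and in which no hyperplane is one-sided, intersects itself or directly self-osculates, and no two hyperplanes interosculate. For an oriented hyperplane $K$ and $\alpha\in H_1(X)=H_1(X;\mathbb{Z})$ let $\alpha.K\in\mathbb{Z}$ be the intersection number, i.e. the value on $\alpha$ of the cellular $1$-cocycle that sends an oriented edge to its signed intersection with $K$. A subset of $X$ is said to separate $X$ if its complement is not connected. Let $f\colon X\to X$ be an automorphism of the cube complex $X$, and suppose that the following three conditions hold. 1. If $K_1\neq K_2$ are hyperplanes with $K_1\cap K_2\neq\emptyset$, then for every choice of orientations of $K_1$ and $K_2$ there exists $\alpha\in H_1(X)$ such that $\alpha.K_1\neq\alpha.K_2$. 2. If $K_1,K_2$ are hyperplanes such that $K_1\cap K_2=\emptyset$ and $K_1\cup K_2$ separates $X$, then every connected component of $X\setminus(K_1\cup K_2)$ contains a hyperplane $L$ that does not separate $X$ and does not meet $K_1$ or $K_2$. 3. If $f(K)=K$ for every hyperplane $K$ of $X$, then $f$ is the identity. Then if $f$ acts trivially on $H_1(X)$, $f$ is the identity. -/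

import Mathlib

noncomputable section

/-- An isometric embedding of the cube `[-1,1]^m` onto an `m`-dimensional face of `[-1,1]^n`.
The `j`-th coordinate of the image of `t` is `sign j * t i` if `src j = some i`, and it is the
constant `sign j` if `src j = none`; every coordinate of `[-1,1]^m` is used exactly once. -/
@[ext]
structure FaceMap (m n : ℕ) where
  src : Fin n → Option (Fin m)
  sign : Fin n → ℤˣ
  exists_unique : ∀ i : Fin m, ∃! j : Fin n, src j = some i

namespace FaceMap

/-- The map of cubes described by the combinatorial data. -/
def apply {m n : ℕ} (φ : FaceMap m n) (t : Fin m → ℝ) : Fin n → ℝ :=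
  fun j => ((φ.sign j : ℤ) : ℝ) * (φ.src j).elim 1 t

/-- The identity of `[-1,1]^n`. -/
def id (n : ℕ) : FaceMap n n where
  src := some
  sign := fun _ => 1
  exists_unique := fun i => ⟨i, rfl, fun _ h => Option.some.inj h⟩

/-- Composition `ψ ∘ φ` of face embeddings. -/
def comp {m n k : ℕ} (ψ : FaceMap n k) (φ : FaceMap m n) : FaceMap m k where
  src := fun l => (ψ.src l).bind φ.src
  sign := fun l => ψ.sign l * (ψ.src l).elim 1 φ.sign
  exists_unique := fun i => by
    obtain ⟨j, hj, hj'⟩ := φ.exists_unique i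
    obtain ⟨l, hl, hl'⟩ := ψ.exists_unique j
    refine ⟨l, by simp [hl, hj], fun l' h => ?_⟩
    obtain ⟨j', h1, h2⟩ := Option.bind_eq_some_iff.1 h
    have := hj' j' h2
    subst this
    exact hl' l' h1

/-- `comp` is composition of the maps of cubes. -/
theorem apply_comp {m n k : ℕ} (ψ : FaceMap n k) (φ : FaceMap m n) (t : Fin m → ℝ) :
    (ψ.comp φ).apply t = ψ.apply (φ.apply t) := by
  funext l
  cases h : ψ.src l <;> simp [apply, comp, h, mul_assoc]

/-- The vertex `ε` of `[-1,1]^n`. -/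
def vertex {n : ℕ} (ε : Fin n → ℤˣ) : FaceMap 0 n where
  src := fun _ => none
  sign := ε
  exists_unique := fun i => i.elim0

/-- The edge of `[-1,1]^n` in the positive `i`-th direction on which, for `j ≠ i`, the `j`-th
coordinate is `ε`. -/
def edge {n : ℕ} (i : Fin n) (ε : ℤˣ) : FaceMap 1 n where
  src := fun j => if j = i then some 0 else none
  sign := fun j => if j = i then 1 else ε
  exists_unique := fun k => by
    refine ⟨i, by simp [Subsingleton.elim k 0], fun j hj => ?_⟩
    by_contra hne
    simp [hne] at hj

/-- The reflection of `[-1,1]`. -/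
def flip : FaceMap 1 1 where
  src := some
  sign := fun _ => -1
  exists_unique := fun i => ⟨i, rfl, fun _ h => Option.some.inj h⟩

end FaceMap

/-- A cube complex, obtained from cubes `[-1,1]^n` by gluing along isometries of faces.
`Cube n` is the set of `n`-cubes together with an isometric parametrisation by `[-1,1]^n`
(so that a geometric `n`-cube gives `2 ^ n * n !` elements of `Cube n`), and `face φ x` is the
restriction of `x` along `φ`. In particular `Cube 0` is the set of vertices and `Cube 1` is the set
of oriented edges. A cube is not folded onto itself by the gluing. -/
structure CubeComplex where
  Cube : ℕ → Type*
  face : ∀ {m n : ℕ}, FaceMap m n → Cube n → Cube m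
  face_id : ∀ {n : ℕ} (x : Cube n), face (FaceMap.id n) x = x
  face_comp : ∀ {m n k : ℕ} (ψ : FaceMap n k) (φ : FaceMap m n) (x : Cube k),
    face (ψ.comp φ) x = face φ (face ψ x)
  free : ∀ {n : ℕ} (x : Cube n) (g : FaceMap n n), face g x = x → g = FaceMap.id n

namespace CubeComplex

universe u

variable (X : CubeComplex.{u})

/-! ### The underlying space -/

/-- The disjoint union of the (parametrised) cubes. -/
abbrev PreSpace : Type u :=
  Σ c : (Σ n : ℕ, X.Cube n), Set.Icc (-1 : Fin c.1 → ℝ) 1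

/-- A point of a face is glued to the same point in the cube. -/
def Glue (p q : X.PreSpace) : Prop :=
  ∃ φ : FaceMap p.1.1 q.1.1, X.face φ q.1.2 = p.1.2 ∧ q.2.1 = φ.apply p.2.1

/-- The underlying topological space of the cube complex, with the quotient topology. -/
def Space : Type u := Quot X.Glue

instance : TopologicalSpace X.Space :=
  inferInstanceAs (TopologicalSpace (Quot X.Glue))

variable {X}

/-- The point with coordinates `t` of the cube `x`. -/
def point {n : ℕ} (x : X.Cube n) (t : Set.Icc (-1 : Fin n → ℝ) 1) : X.Space :=
  Quot.mk _ ⟨⟨n, x⟩, t⟩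

/-! ### Edges, squares, and non-positive curvature -/

/-- Initial vertex of an oriented edge. -/
def init (e : X.Cube 1) : X.Cube 0 := X.face (FaceMap.vertex fun _ => -1) e

/-- Terminal vertex of an oriented edge. -/
def term (e : X.Cube 1) : X.Cube 0 := X.face (FaceMap.vertex fun _ => 1) e

/-- The same edge with the opposite orientation. -/
def rev (e : X.Cube 1) : X.Cube 1 := X.face FaceMap.flip e

/-- The oriented edges `a`, `b` issue from a common vertex and span a corner of a square there,
i.e. they are adjacent in the link of that vertex. -/
def Corner (a b : X.Cube 1) : Prop :=
  ∃ x : X.Cube 2, X.face (FaceMap.edge 0 (-1)) x = a ∧ X.face (FaceMap.edge 1 (-1)) x = b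

variable (X) in
/-- Gromov's condition: the link of every vertex `v` is a flag simplicial complex. The vertices of
the link are the oriented edges issuing from `v`; its `(n-1)`-simplices are the corners of
`n`-cubes at `v`. -/
structure IsNPC : Prop where
  no_loop : ∀ a : X.Cube 1, ¬ Corner a a
  flag : ∀ (v : X.Cube 0) (n : ℕ) (a : Fin n → X.Cube 1), (∀ i, init (a i) = v) →
    (∀ i j, i ≠ j → Corner (a i) (a j)) →
    ∃! x : X.Cube n, X.face (FaceMap.vertex fun _ => -1) x = v ∧
      ∀ i, X.face (FaceMap.edge i (-1)) x = a i

/-! ### Hyperplanes -/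

/-- `a` and `b` are opposite edges of a square, with the same orientation. -/
def ElemParallel (a b : X.Cube 1) : Prop :=
  ∃ x : X.Cube 2, X.face (FaceMap.edge 0 (-1)) x = a ∧ X.face (FaceMap.edge 0 1) x = b

variable (X) in
/-- Oriented hyperplanes: classes of oriented edges under the equivalence relation generated by
`ElemParallel` (parallelism of oriented edges). -/
def OrientedHyperplane : Type u := Quot (ElemParallel (X := X))

variable (X) in
/-- Hyperplanes: classes of edges under parallelism, the orientation being disregarded. -/
def Hyperplane : Type u :=
  Quot fun a b : X.Cube 1 => ElemParallel a b ∨ b = rev a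

/-- The oriented hyperplane dual to an oriented edge. -/
def orientedDual (e : X.Cube 1) : X.OrientedHyperplane := Quot.mk _ e

/-- The hyperplane dual to an edge. -/
def dual (e : X.Cube 1) : X.Hyperplane := Quot.mk _ e

/-- Forget the orientation of a hyperplane. -/
def OrientedHyperplane.forget (E : X.OrientedHyperplane) : X.Hyperplane :=
  Quot.map _root_.id (fun _ _ h => Or.inl h) E

/-- A hyperplane as a subset of the space: the union of the midcubes `t i = 0` over all cubes `x`
and all directions `i` for which the edges of `x` in direction `i` are dual to the hyperplane. -/
def Hyperplane.carrier (K : X.Hyperplane) : Set X.Space :=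
  {p | ∃ (n : ℕ) (x : X.Cube n) (i : Fin n) (t : Set.Icc (-1 : Fin n → ℝ) 1),
    dual (X.face (FaceMap.edge i (-1)) x) = K ∧ t.1 i = 0 ∧ p = point x t}

/-- A subset separates the space if its complement is not connected. -/
def Separates (A : Set X.Space) : Prop := ¬ IsPreconnected Aᶜ

variable (X) in
/-- Special cube complexes: non-positively curved, with no one-sided hyperplane, no
self-intersecting hyperplane, no directly self-osculating hyperplane and no pair of interosculating
hyperplanes. -/
structure IsSpecial : Prop where
  npc : X.IsNPC
  two_sided : ∀ a : X.Cube 1, orientedDual a ≠ orientedDual (rev a)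
  no_self_intersection : ∀ a b : X.Cube 1, Corner a b → dual a ≠ dual b
  no_self_osculation : ¬ ∃ a b : X.Cube 1, a ≠ b ∧ init a = init b ∧
    orientedDual a = orientedDual b ∧ ¬ Corner a b
  no_interosculation : ¬ ∃ a b a' b' : X.Cube 1, dual a ≠ dual b ∧
    (Corner a' b' ∧ dual a' = dual a ∧ dual b' = dual b) ∧ (init a = init b ∧ ¬ Corner a b)

variable (X) in
/-- Compactness of a cube complex: there are only finitely many cubes. -/
def IsCompactComplex : Prop := Finite (Σ n : ℕ, X.Cube n)

/-! ### First homology and intersection numbers -/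

variable (X) in
/-- The cellular boundary map on formal sums of oriented edges. -/
def boundaryOne : (X.Cube 1 →₀ ℤ) →ₗ[ℤ] (X.Cube 0 →₀ ℤ) :=
  Finsupp.lmapDomain ℤ ℤ term - Finsupp.lmapDomain ℤ ℤ init

/-- The boundary of a square. -/
def boundarySquare (x : X.Cube 2) : X.Cube 1 →₀ ℤ :=
  Finsupp.single (X.face (FaceMap.edge 0 (-1)) x) 1 +
  Finsupp.single (X.face (FaceMap.edge 1 1) x) 1 -
  Finsupp.single (X.face (FaceMap.edge 0 1) x) 1 -
  Finsupp.single (X.face (FaceMap.edge 1 (-1)) x) 1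

variable (X) in
/-- The null-homologous formal sums of oriented edges: they are generated by the boundaries of
squares and by the relations `rev e = - e` of the cellular chain group. -/
def nullOne : Submodule ℤ (X.Cube 1 →₀ ℤ) :=
  Submodule.span ℤ
    (Set.range (fun e : X.Cube 1 => Finsupp.single e (1 : ℤ) + Finsupp.single (rev e) 1) ∪
      Set.range (boundarySquare (X := X)))

variable (X) in
/-- The first (cellular) homology group of `X` with integer coefficients. -/
abbrev H1 : Type u :=
  LinearMap.ker X.boundaryOne ⧸ (X.nullOne).submoduleOf (LinearMap.ker X.boundaryOne)

theorem elemParallel_edge_one (x : X.Cube 2) :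
    ElemParallel (X.face (FaceMap.edge 1 (-1)) x) (X.face (FaceMap.edge 1 1) x) := by
  let g : FaceMap 2 2 :=
    { src := fun j => some (Equiv.swap 0 1 j)
      sign := fun _ => 1
      exists_unique := fun i => ⟨Equiv.swap 0 1 i, by simp, fun j hj => by
        rw [← Option.some.inj hj]; simp⟩ }
  have key : ∀ δ : ℤˣ, g.comp (FaceMap.edge 0 δ) = FaceMap.edge 1 δ := by
    intro δ
    ext j : 2
    · fin_cases j <;> rfl
    · fin_cases j <;> simp [FaceMap.comp, FaceMap.edge, g]
  exact ⟨X.face g x, by rw [← X.face_comp, key], by rw [← X.face_comp, key]⟩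

theorem rev_rev (e : X.Cube 1) : rev (rev e) = e := by
  have : FaceMap.flip.comp FaceMap.flip = FaceMap.id 1 := by
    ext j : 2
    · rfl
    · simp [FaceMap.comp, FaceMap.flip, FaceMap.id]
  rw [rev, rev, ← X.face_comp, this, X.face_id]

theorem ElemParallel.rev {a b : X.Cube 1} (h : ElemParallel a b) :
    ElemParallel (CubeComplex.rev a) (CubeComplex.rev b) := by
  obtain ⟨x, rfl, rfl⟩ := h
  let g : FaceMap 2 2 :=
    { src := some
      sign := fun j => if j = 0 then -1 else 1
      exists_unique := fun i => ⟨i, rfl, fun _ h => Option.some.inj h⟩ }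
  have key : ∀ δ : ℤˣ, g.comp (FaceMap.edge 0 δ) = (FaceMap.edge 0 δ).comp FaceMap.flip := by
    intro δ
    ext j : 2
    · fin_cases j <;> rfl
    · fin_cases j <;> simp [FaceMap.comp, FaceMap.edge, FaceMap.flip, g]
  refine ⟨X.face g x, ?_, ?_⟩ <;>
    rw [← X.face_comp, key, X.face_comp] <;> rfl

open Classical in
/-- Signed intersection of an oriented edge with an oriented hyperplane. -/
def edgeSign (E : X.OrientedHyperplane) (e : X.Cube 1) : ℤ :=
  (if orientedDual e = E then 1 else 0) - (if orientedDual (rev e) = E then 1 else 0)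

theorem edgeSign_rev (E : X.OrientedHyperplane) (e : X.Cube 1) :
    edgeSign E (rev e) = - edgeSign E e := by
  rw [edgeSign, edgeSign, CubeComplex.rev_rev]
  ring

theorem edgeSign_congr (E : X.OrientedHyperplane) {a b : X.Cube 1} (h : ElemParallel a b) :
    edgeSign E a = edgeSign E b := by
  have h1 : orientedDual a = orientedDual b := Quot.sound h
  have h2 : orientedDual (rev a) = orientedDual (rev b) := Quot.sound h.rev
  rw [edgeSign, edgeSign, h1, h2]

/-- The cochain of an oriented hyperplane: the signed intersection, extended linearly. -/
def cochain (E : X.OrientedHyperplane) : (X.Cube 1 →₀ ℤ) →ₗ[ℤ] ℤ :=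
  Finsupp.linearCombination ℤ (edgeSign E)

theorem nullOne_le_ker_cochain (E : X.OrientedHyperplane) :
    X.nullOne ≤ LinearMap.ker (cochain E) := by
  rw [nullOne, Submodule.span_le]
  rintro _ (⟨e, rfl⟩ | ⟨x, rfl⟩)
  · simp [cochain, edgeSign_rev]
  · have h0 := edgeSign_congr E
      (show ElemParallel (X.face (FaceMap.edge 0 (-1)) x) (X.face (FaceMap.edge 0 1) x) from
        ⟨x, rfl, rfl⟩)
    have h1 := edgeSign_congr E (elemParallel_edge_one x)
    simp [cochain, boundarySquare, h0, h1]

/-- The intersection number `α . E` of a homology class with an oriented hyperplane. -/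
def intersection (E : X.OrientedHyperplane) : X.H1 →ₗ[ℤ] ℤ :=
  Submodule.liftQ _ (cochain E ∘ₗ (LinearMap.ker X.boundaryOne).subtype)
    (fun _ hc => nullOne_le_ker_cochain E hc)

/-! ### Automorphisms -/

variable (X) in
/-- Automorphisms of a cube complex: bijections on parametrised cubes of every dimension that are
compatible with all faces and reparametrisations. -/
@[ext]
structure Automorphism where
  map : ∀ n : ℕ, X.Cube n ≃ X.Cube n
  map_face : ∀ {m n : ℕ} (φ : FaceMap m n) (x : X.Cube n),
    map m (X.face φ x) = X.face φ (map n x)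

namespace Automorphism

variable (X) in
/-- The identity automorphism. -/
def refl : X.Automorphism where
  map := fun _ => Equiv.refl _
  map_face := fun _ _ => rfl

variable (f : X.Automorphism)

theorem elemParallel {a b : X.Cube 1} (h : ElemParallel a b) :
    ElemParallel (f.map 1 a) (f.map 1 b) := by
  obtain ⟨x, rfl, rfl⟩ := h
  exact ⟨f.map 2 x, (f.map_face _ x).symm, (f.map_face _ x).symm⟩

/-- The image `f(K)` of a hyperplane. -/
def mapHyperplane : X.Hyperplane → X.Hyperplane :=
  Quot.map (f.map 1) (by
    rintro a b (h | rfl)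
    · exact Or.inl (f.elemParallel h)
    · exact Or.inr (f.map_face _ a))

/-- The induced map on formal sums of oriented edges. -/
def mapChain : (X.Cube 1 →₀ ℤ) →ₗ[ℤ] (X.Cube 1 →₀ ℤ) := Finsupp.lmapDomain ℤ ℤ (f.map 1)

theorem boundaryOne_mapChain (c : X.Cube 1 →₀ ℤ) :
    X.boundaryOne (f.mapChain c) = Finsupp.lmapDomain ℤ ℤ (f.map 0) (X.boundaryOne c) := by
  induction c using Finsupp.induction_linear with
  | zero => simp
  | add a b ha hb => rw [map_add, map_add, ha, hb, map_add, map_add]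
  | single e r =>
    simp only [boundaryOne, mapChain, LinearMap.sub_apply, map_sub, Finsupp.lmapDomain_apply,
      Finsupp.mapDomain_single, init, term, f.map_face]

theorem mapChain_mem_ker (c : X.Cube 1 →₀ ℤ) (hc : c ∈ LinearMap.ker X.boundaryOne) :
    f.mapChain c ∈ LinearMap.ker X.boundaryOne := by
  rw [LinearMap.mem_ker] at hc ⊢
  rw [boundaryOne_mapChain, hc, map_zero]

theorem nullOne_le_comap : X.nullOne ≤ X.nullOne.comap f.mapChain := by
  rw [nullOne, Submodule.span_le]
  rintro _ (⟨e, rfl⟩ | ⟨x, rfl⟩)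
  · refine Submodule.subset_span (Or.inl ⟨f.map 1 e, ?_⟩)
    simp [mapChain, Finsupp.mapDomain_add, Finsupp.mapDomain_single, rev, f.map_face]
  · refine Submodule.subset_span (Or.inr ⟨f.map 2 x, ?_⟩)
    simp only [mapChain, boundarySquare, map_sub, map_add, Finsupp.lmapDomain_apply,
      Finsupp.mapDomain_single, f.map_face]

/-- The induced map on first homology. -/
def mapH1 : X.H1 →ₗ[ℤ] X.H1 :=
  Submodule.mapQ _ _ (f.mapChain.restrict f.mapChain_mem_ker)
    (fun _ hc => f.nullOne_le_comap hc)

end Automorphism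

end CubeComplex

end

/-!
The proof is carried out on the vertices of `X`. A set of vertices that is connected with its
complement only by edges dual to the hyperplanes in `𝒦` determines a decomposition of the complement
of these hyperplanes into two open sets (`cornerSet`, `mem_cornerSet_or`). Hence the second
hypothesis can be applied to sets of vertices, and nothing else is needed from the topology of `X`.
Connectedness of `X` is not assumed; it follows as soon as there is a nonseparating hyperplane.

An equality `intersection E = intersection F` means that the difference of the two cocycles is the
coboundary of an integral function on the vertices. A hyperplane does not cross itself, and by the
first hypothesis it does not cross a different one with the same intersection numbers. So such a
function is constant along each side of `E` and of `F`, and a superlevel set is a region bounded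
by `E` and `F`, or by `E` alone if its intersection numbers vanish (`exists_isRegion`,
`exists_bounds`). As `f` acts trivially on homology, this applies to `E` and `F = f E`. It has to
be shown that `f` fixes every hyperplane.

* Suppose that the intersection numbers of `E` vanish and that `E` is moved. Let `P` be the side of
  `E` which does not contain `f E`. Then `P` is contained in `f P` or disjoint from it, and the
  former is excluded by counting vertices. The second hypothesis gives a nonseparating hyperplane
  `L` in `P`, and `f L` lies in `f P`. As `L` and `f L` bound a region, and membership in this
  region is constant along the side of `E` in `P`, `L` is separating after all (`false_of_bounds`).
* Suppose that `E` has a nonzero intersection number and is moved. Among the regions between `E` and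
  the other oriented hyperplanes with the same intersection numbers take a smallest one, `A`. It
  contains no hyperplane with these intersection numbers (`exists_isRegion_minimal`), which implies
  that `A` and `f A` are disjoint. Again there is a nonseparating hyperplane `L` in `A`, and the
  region between `L` and `f L`, restricted to `A`, shows that `L` separates, or that `L` and the two
  hyperplanes bounding `A` have the same intersection numbers up to orientation, which is impossible
  (`mapOriented_eq_of_intersection_ne_zero`).
-/

/-! ### Edges and squares of a standard cube -/

namespace FaceMap

/-- The edge of `[-1,1]^n` in the positive `i`-th direction on which, for `j ≠ i`, the `j`-th
coordinate is `ε j`. -/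
def edgeAt {n : ℕ} (i : Fin n) (ε : Fin n → ℤˣ) : FaceMap 1 n where
  src := fun j => if j = i then some 0 else none
  sign := fun j => if j = i then 1 else ε j
  exists_unique := fun k => by
    refine ⟨i, by simp [Subsingleton.elim k 0], fun j hj => ?_⟩
    by_contra hne
    simp [hne] at hj

/-- The square of `[-1,1]^n` in the positive directions `i` and `j` (in this order) on which, for
`k ≠ i, j`, the `k`-th coordinate is `ε k`. -/
def squareAt {n : ℕ} {i j : Fin n} (hij : i ≠ j) (ε : Fin n → ℤˣ) : FaceMap 2 n where
  src := fun k => if k = i then some 0 else if k = j then some 1 else none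
  sign := fun k => if k = i then 1 else if k = j then 1 else ε k
  exists_unique := fun l => by
    fin_cases l
    · refine ⟨i, by simp, fun k hk => ?_⟩
      by_contra hne
      by_cases hkj : k = j <;> simp [hne, hkj, hij.symm] at hk
    · refine ⟨j, by simp [hij.symm], fun k hk => ?_⟩
      by_contra hne
      by_cases hki : k = i <;> simp [hne, hki] at hk

theorem comp_vertex {m n : ℕ} (φ : FaceMap m n) (δ : Fin m → ℤˣ) :
    φ.comp (vertex δ) = vertex fun j => φ.sign j * (φ.src j).elim 1 δ := by
  ext j : 2
  · simp only [comp, vertex]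
    cases φ.src j <;> rfl
  · rfl

theorem edgeAt_comp_vertex {n : ℕ} (i : Fin n) (ε : Fin n → ℤˣ) (u : ℤˣ) :
    (edgeAt i ε).comp (vertex fun _ => u) = vertex (Function.update ε i u) := by
  rw [comp_vertex]
  congr 1
  funext j
  by_cases h : j = i
  · subst h; simp [edgeAt]
  · simp [edgeAt, h]

theorem squareAt_comp_edge_zero {n : ℕ} {i j : Fin n} (hij : i ≠ j) (ε : Fin n → ℤˣ) (u : ℤˣ) :
    (squareAt hij ε).comp (edge 0 u) = edgeAt i (Function.update ε j u) := by
  ext k : 2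
  · by_cases hi : k = i
    · simp [comp, squareAt, edge, edgeAt, hi]
    · by_cases hj : k = j <;> simp [comp, squareAt, edge, edgeAt, hi, hj, hij.symm]
  · by_cases hi : k = i
    · simp [comp, squareAt, edge, edgeAt, hi]
    · by_cases hj : k = j <;> simp [comp, squareAt, edge, edgeAt, hi, hj, hij.symm]

theorem edgeAt_const {n : ℕ} (i : Fin n) (u : ℤˣ) : edgeAt i (fun _ => u) = edge i u := rfl

theorem edge_one_one (u : ℤˣ) : edge (0 : Fin 1) u = id 1 := by
  ext j : 2 <;> simp [edge, id, Subsingleton.elim j 0]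

end FaceMap

/-- A function that is unchanged whenever a single coordinate is replaced by an admissible value
takes the same value at all vectors with admissible coordinates. -/
theorem eq_of_forall_update_eq {ι β γ : Type*} [Fintype ι] [DecidableEq ι] (F : (ι → β) → γ)
    (Q : ι → β → Prop)
    (hF : ∀ ε i u, (∀ j, Q j (ε j)) → Q i u → F (Function.update ε i u) = F ε)
    {ε δ : ι → β} (hε : ∀ i, Q i (ε i)) (hδ : ∀ i, Q i (δ i)) : F ε = F δ := by
  have key : ∀ s : Finset ι, F (s.piecewise ε δ) = F δ := by
    intro s
    induction s using Finset.induction_on with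
    | empty => simp
    | insert i s _ ih =>
      rw [Finset.piecewise_insert, hF _ _ _ _ (hε i), ih]
      intro j
      by_cases hj : j ∈ s <;> simp [hj, hε, hδ]
  simpa using key Finset.univ

namespace CubeComplex

universe u

variable {X : CubeComplex.{u}}

/-! ### Edges of a cube -/

/-- All edges of a cube in one direction are parallel: the signs of the other coordinates can be
changed one at a time, across a square. -/
theorem orientedDual_face_edgeAt {n : ℕ} (x : X.Cube n) (i : Fin n) (ε δ : Fin n → ℤˣ) :
    orientedDual (X.face (FaceMap.edgeAt i ε) x) =
      orientedDual (X.face (FaceMap.edgeAt i δ) x) := by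
  refine eq_of_forall_update_eq
    (fun ε => orientedDual (X.face (FaceMap.edgeAt i ε) x)) (fun _ _ => True) ?_
    (fun _ => trivial) (fun _ => trivial)
  intro ε j u _ _
  by_cases hij : i = j
  · -- the `i`-th sign is irrelevant for an edge in direction `i`
    subst hij
    have : FaceMap.edgeAt i (Function.update ε i u) = FaceMap.edgeAt i ε := by
      ext k : 2
      · rfl
      · by_cases h : k = i <;> simp [FaceMap.edgeAt, h]
    simp only [this]
  · have key : orientedDual (X.face (FaceMap.edgeAt i (Function.update ε j (-1))) x) =
        orientedDual (X.face (FaceMap.edgeAt i (Function.update ε j 1)) x) := by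
      refine Quot.sound ⟨X.face (FaceMap.squareAt hij ε) x, ?_, ?_⟩ <;>
        rw [← X.face_comp, FaceMap.squareAt_comp_edge_zero]
    have all : ∀ u v : ℤˣ,
        orientedDual (X.face (FaceMap.edgeAt i (Function.update ε j u)) x) =
          orientedDual (X.face (FaceMap.edgeAt i (Function.update ε j v)) x) := by
      intro u v
      rcases Int.units_eq_one_or u with rfl | rfl <;>
        rcases Int.units_eq_one_or v with rfl | rfl <;> first | rfl | exact key | exact key.symm
    simpa using all u (ε j)

theorem forget_orientedDual (e : X.Cube 1) : (orientedDual e).forget = dual e := rfl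

theorem dual_face_edgeAt {n : ℕ} (x : X.Cube n) (i : Fin n) (ε : Fin n → ℤˣ) :
    dual (X.face (FaceMap.edgeAt i ε) x) = dual (X.face (FaceMap.edge i (-1)) x) := by
  rw [← FaceMap.edgeAt_const, ← forget_orientedDual, ← forget_orientedDual,
    orientedDual_face_edgeAt x i ε]

/-! ### Open sets determined by sets of vertices -/

/-- In the cube that carries the point `p`, all vertices of the orthants containing `p` belong to
`W`. A vanishing coordinate of `p` is compatible with both signs. -/
def PreSpace.Near (W : Set (X.Cube 0)) (p : X.PreSpace) : Prop :=
  ∀ ε : Fin p.1.1 → ℤˣ, (∀ i, 0 ≤ ((ε i : ℤ) : ℝ) * p.2.1 i) → X.face (FaceMap.vertex ε) p.1.2 ∈ W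

theorem units_mul_self_mul (u : ℤˣ) (r : ℝ) : ((u : ℤ) : ℝ) * (((u : ℤ) : ℝ) * r) = r := by
  rcases Int.units_eq_one_or u with rfl | rfl <;> simp

theorem units_eq_of_mul_nonneg {u v : ℤˣ} (h : 0 ≤ ((u : ℤ) : ℝ) * ((v : ℤ) : ℝ)) : u = v := by
  rcases Int.units_eq_one_or u with rfl | rfl <;>
    rcases Int.units_eq_one_or v with rfl | rfl <;> first | rfl | (exfalso; norm_num at h)

theorem near_iff_of_glue (W : Set (X.Cube 0)) {p q : X.PreSpace} (h : X.Glue p q) :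
    PreSpace.Near W p ↔ PreSpace.Near W q := by
  obtain ⟨⟨m, x⟩, t, ht⟩ := p
  obtain ⟨⟨n, y⟩, s, hs⟩ := q
  obtain ⟨φ, hφ, hst⟩ := h
  change FaceMap m n at φ
  change X.face φ y = x at hφ
  change s = φ.apply t at hst
  subst hφ hst
  simp only [PreSpace.Near, ← X.face_comp, FaceMap.comp_vertex]
  constructor
  · intro h ε hε
    choose j hj hj' using φ.exists_unique
    have key : (fun k => φ.sign k * (φ.src k).elim 1 fun i => φ.sign (j i) * ε (j i)) = ε := by
      funext k
      have hk := hε k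
      simp only [FaceMap.apply] at hk
      cases hsrc : φ.src k with
      | none =>
        simp only [hsrc, Option.elim, mul_one] at hk
        simp [(units_eq_of_mul_nonneg hk)]
      | some i =>
        obtain rfl := hj' i k hsrc
        simp [← mul_assoc]
    have := h (fun i => φ.sign (j i) * ε (j i)) fun i => by
      have := hε (j i)
      simp only [FaceMap.apply, hj i, Option.elim] at this
      push_cast
      calc (0 : ℝ) ≤ _ := this
        _ = _ := by ring
    rwa [key] at this
  · intro h δ hδ
    refine h _ fun k => ?_
    simp only [FaceMap.apply]
    push_cast
    rw [mul_assoc, mul_left_comm, units_mul_self_mul]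
    cases φ.src k with
    | none => simp
    | some i => exact hδ i

/-- The points of the space for which all vertices of the orthants containing the point belong to
`W`; this does not depend on the cube in which the point is represented. -/
def cornerSet (W : Set (X.Cube 0)) : Set X.Space :=
  {p | Quot.lift (PreSpace.Near W) (fun _ _ h => propext (near_iff_of_glue W h)) p}

theorem point_mem_cornerSet {W : Set (X.Cube 0)} {n : ℕ} {x : X.Cube n}
    {t : Set.Icc (-1 : Fin n → ℝ) 1} :
    point x t ∈ cornerSet W ↔ ∀ ε : Fin n → ℤˣ, (∀ i, 0 ≤ ((ε i : ℤ) : ℝ) * t.1 i) →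
      X.face (FaceMap.vertex ε) x ∈ W :=
  Iff.rfl

theorem isOpen_cornerSet (W : Set (X.Cube 0)) : IsOpen (cornerSet W) := by
  have hq : Topology.IsQuotientMap (Quot.mk X.Glue) := isQuotientMap_quot_mk
  refine hq.isOpen_preimage.1 ?_
  rw [isOpen_sigma_iff]
  rintro ⟨n, x⟩
  have : Sigma.mk ⟨n, x⟩ ⁻¹' (Quot.mk X.Glue ⁻¹' cornerSet W) =
      (⋃ ε ∈ {ε : Fin n → ℤˣ | X.face (FaceMap.vertex ε) x ∉ W},
        {t : Set.Icc (-1 : Fin n → ℝ) 1 | ∀ i, 0 ≤ ((ε i : ℤ) : ℝ) * t.1 i})ᶜ := by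
    ext t
    simp only [Set.mem_preimage, Set.mem_compl_iff, Set.mem_iUnion, Set.mem_ofPred_eq]
    change (point x t ∈ cornerSet W) ↔ _
    rw [point_mem_cornerSet]
    push Not
    exact forall_congr' fun ε => by rw [← not_imp_not]; push Not; rfl
  rw [this, isOpen_compl_iff]
  refine (Set.toFinite _).isClosed_biUnion fun ε _ => ?_
  simp only [Set.ofPred_forall]
  exact isClosed_iInter fun i => isClosed_le continuous_const
    (continuous_const.mul ((continuous_apply i).comp continuous_subtype_val))

theorem disjoint_cornerSet (W : Set (X.Cube 0)) : Disjoint (cornerSet W) (cornerSet Wᶜ) := by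
  rw [Set.disjoint_left]
  rintro ⟨⟨n, x⟩, t⟩ h h'
  have hs : ∀ r : ℝ, ∃ u : ℤˣ, 0 ≤ ((u : ℤ) : ℝ) * r := fun r =>
    (le_total 0 r).elim (fun h => ⟨1, by simpa using h⟩) (fun h => ⟨-1, by simpa using h⟩)
  choose σ hσ using hs
  exact h' (fun i => σ (t.1 i)) (fun i => hσ _) (h (fun i => σ (t.1 i)) fun i => hσ _)

/-- Every edge that connects the set of vertices `W` with its complement is dual to a hyperplane in
`𝒦`. -/
def ClosedOff (𝒦 : Set X.Hyperplane) (W : Set (X.Cube 0)) : Prop :=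
  ∀ e : X.Cube 1, dual e ∉ 𝒦 → (init e ∈ W ↔ term e ∈ W)

/-- Off the hyperplanes in `𝒦`, the open sets determined by `W` and by its complement cover the
space, because the vertices of the orthants containing a point are connected by edges whose dual
hyperplanes pass through this point. -/
theorem mem_cornerSet_or {𝒦 : Set X.Hyperplane} {W : Set (X.Cube 0)} (hW : ClosedOff 𝒦 W)
    {p : X.Space} (hp : ∀ K ∈ 𝒦, p ∉ K.carrier) : p ∈ cornerSet W ∨ p ∈ cornerSet Wᶜ := by
  obtain ⟨⟨⟨n, x⟩, t⟩, rfl⟩ := Quot.exists_rep p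
  change ∀ K ∈ 𝒦, point x t ∉ K.carrier at hp
  change point x t ∈ cornerSet W ∨ point x t ∈ cornerSet Wᶜ
  simp only [point_mem_cornerSet]
  have key : ∀ ε δ : Fin n → ℤˣ, (∀ i, 0 ≤ ((ε i : ℤ) : ℝ) * t.1 i) →
      (∀ i, 0 ≤ ((δ i : ℤ) : ℝ) * t.1 i) →
      (X.face (FaceMap.vertex ε) x ∈ W) = (X.face (FaceMap.vertex δ) x ∈ W) := by
    intro ε δ hε hδ
    refine eq_of_forall_update_eq (fun ε => X.face (FaceMap.vertex ε) x ∈ W)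
      (fun i u => 0 ≤ ((u : ℤ) : ℝ) * t.1 i) ?_ hε hδ
    intro ε i u hε hu
    rcases eq_or_ne u (ε i) with rfl | hne
    · simp
    -- two opposite signs are admissible only if the coordinate vanishes
    have hneg : u = -ε i := by
      rcases Int.units_eq_one_or u with rfl | rfl <;>
        rcases Int.units_eq_one_or (ε i) with h | h <;> simp_all
    have ht : t.1 i = 0 := by
      have h1 := hε i
      rw [hneg] at hu
      rcases Int.units_eq_one_or (ε i) with h | h <;> rw [h] at h1 hu <;> norm_num at h1 hu <;>
        linarith
    have hK : dual (X.face (FaceMap.edgeAt i ε) x) ∉ 𝒦 := fun hmem =>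
      hp _ hmem ⟨n, x, i, t, (dual_face_edgeAt x i ε).symm, ht, rfl⟩
    have := hW _ hK
    rw [init, term, ← X.face_comp, ← X.face_comp, FaceMap.edgeAt_comp_vertex,
      FaceMap.edgeAt_comp_vertex] at this
    have all : ∀ u v : ℤˣ, X.face (FaceMap.vertex (Function.update ε i u)) x ∈ W ↔
        X.face (FaceMap.vertex (Function.update ε i v)) x ∈ W := by
      intro u v
      rcases Int.units_eq_one_or u with rfl | rfl <;>
        rcases Int.units_eq_one_or v with rfl | rfl <;>
        first | rfl | exact this | exact this.symm
    have h := all u (ε i)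
    rw [Function.update_eq_self] at h
    exact propext h
  by_cases h : ∃ ε : Fin n → ℤˣ, (∀ i, 0 ≤ ((ε i : ℤ) : ℝ) * t.1 i) ∧
      X.face (FaceMap.vertex ε) x ∈ W
  · obtain ⟨ε, hε, hmem⟩ := h
    exact Or.inl fun δ hδ => by rwa [← key ε δ hε hδ]
  · push Not at h
    exact Or.inr h

/-- A connected set that avoids the hyperplanes in `𝒦` and meets the open set determined by `W` lies
in this open set. -/
theorem subset_cornerSet {𝒦 : Set X.Hyperplane} {W : Set (X.Cube 0)} (hW : ClosedOff 𝒦 W)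
    {C : Set X.Space} (hC : IsPreconnected C) (hd : ∀ p ∈ C, ∀ K ∈ 𝒦, p ∉ K.carrier)
    {p : X.Space} (hp : p ∈ C) (hpW : p ∈ cornerSet W) : C ⊆ cornerSet W :=
  hC.subset_left_of_subset_union (isOpen_cornerSet W) (isOpen_cornerSet Wᶜ) (disjoint_cornerSet W)
    (fun q hq => mem_cornerSet_or hW (hd q hq)) ⟨p, hp, hpW⟩

/-- A vertex as a point of the space. -/
def vertexPoint (v : X.Cube 0) : X.Space := point v ⟨0, by simp, by simp⟩

/-- The midpoint of an edge. -/
def midpoint (e : X.Cube 1) : X.Space := point e ⟨0, by simp, by simp⟩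

theorem face_vertex_zero (v : X.Cube 0) (ε : Fin 0 → ℤˣ) : X.face (FaceMap.vertex ε) v = v := by
  have : FaceMap.vertex ε = FaceMap.id 0 := by
    ext j : 2 <;> exact j.elim0
  rw [this, X.face_id]

theorem vertexPoint_mem_cornerSet {W : Set (X.Cube 0)} {v : X.Cube 0} :
    vertexPoint v ∈ cornerSet W ↔ v ∈ W := by
  rw [vertexPoint, point_mem_cornerSet]
  simp [face_vertex_zero]

theorem endpoints_mem_of_midpoint_mem {W : Set (X.Cube 0)} {e : X.Cube 1}
    (h : midpoint e ∈ cornerSet W) : init e ∈ W ∧ term e ∈ W :=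
  ⟨h _ fun i => by simp, h _ fun i => by simp⟩

theorem midpoint_mem_carrier (e : X.Cube 1) : midpoint e ∈ (dual e).carrier :=
  ⟨1, e, 0, _, by rw [FaceMap.edge_one_one, X.face_id], rfl, rfl⟩

/-! ### Separation by hyperplanes -/

/-- That some coordinate of a point vanishes does not depend on the cube in which it is represented,
and it holds on hyperplanes. -/
theorem exists_eq_zero_of_mem_carrier {K : X.Hyperplane} {n : ℕ} {x : X.Cube n}
    {t : Set.Icc (-1 : Fin n → ℝ) 1} (h : point x t ∈ K.carrier) : ∃ i, t.1 i = 0 := by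
  have hglue : ∀ p q : X.PreSpace, X.Glue p q → (∃ i, p.2.1 i = 0) = (∃ i, q.2.1 i = 0) := by
    rintro p q ⟨φ, -, hφ⟩
    rw [hφ]
    refine propext ⟨?_, ?_⟩
    · rintro ⟨i, hi⟩
      obtain ⟨j, hj, -⟩ := φ.exists_unique i
      exact ⟨j, by simp [FaceMap.apply, hj, hi]⟩
    · rintro ⟨j, hj⟩
      have hs : ((φ.sign j : ℤ) : ℝ) ≠ 0 := by
        rcases Int.units_eq_one_or (φ.sign j) with h | h <;> simp [h]
      cases hsrc : φ.src j with
      | none => simp [FaceMap.apply, hsrc, hs] at hj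
      | some i => exact ⟨i, by simpa [FaceMap.apply, hsrc, hs] using hj⟩
  obtain ⟨m, y, i, s, -, hs, hp⟩ := h
  have := congrArg (Quot.lift (fun p : X.PreSpace => ∃ i, p.2.1 i = 0) hglue) hp
  exact cast this.symm ⟨i, hs⟩

theorem vertexPoint_notMem_carrier (v : X.Cube 0) (K : X.Hyperplane) :
    vertexPoint v ∉ K.carrier := fun h =>
  (exists_eq_zero_of_mem_carrier h).elim fun i _ => i.elim0

theorem vertexPoint_mem_compl (v : X.Cube 0) (K M : X.Hyperplane) :
    vertexPoint v ∈ (K.carrier ∪ M.carrier)ᶜ := fun h =>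
  h.elim (vertexPoint_notMem_carrier v K) (vertexPoint_notMem_carrier v M)

theorem separates_of_closedOff {K M : X.Hyperplane} {W : Set (X.Cube 0)}
    (hW : ClosedOff {K, M} W) {v w : X.Cube 0} (hv : v ∈ W) (hw : w ∉ W) :
    Separates (K.carrier ∪ M.carrier) := by
  intro hC
  refine hw (vertexPoint_mem_cornerSet.1 (subset_cornerSet hW hC ?_ (vertexPoint_mem_compl v K M)
    (vertexPoint_mem_cornerSet.2 hv) (vertexPoint_mem_compl w K M)))
  rintro p hp N (rfl | rfl) hN
  exacts [hp (Or.inl hN), hp (Or.inr hN)]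

theorem mem_of_not_separates {L : X.Hyperplane} (hL : ¬ Separates L.carrier) {W : Set (X.Cube 0)}
    (hW : ClosedOff {L} W) {v : X.Cube 0} (hv : v ∈ W) (w : X.Cube 0) : w ∈ W := by
  refine vertexPoint_mem_cornerSet.1 (subset_cornerSet hW (not_not.1 hL) ?_
    (vertexPoint_notMem_carrier v L) (vertexPoint_mem_cornerSet.2 hv)
    (vertexPoint_notMem_carrier w L))
  rintro p hp N rfl hN
  exact hp hN

theorem endpoints_mem_of_carrier_subset {K M L : X.Hyperplane} {W : Set (X.Cube 0)}
    (hW : ClosedOff {K, M} W) {v : X.Cube 0} (hv : v ∈ W)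
    (hL : L.carrier ⊆ connectedComponentIn (K.carrier ∪ M.carrier)ᶜ (vertexPoint v))
    {e : X.Cube 1} (he : dual e = L) : init e ∈ W ∧ term e ∈ W := by
  subst he
  refine endpoints_mem_of_midpoint_mem (subset_cornerSet hW isPreconnected_connectedComponentIn ?_
    (mem_connectedComponentIn (vertexPoint_mem_compl v K M))
    (vertexPoint_mem_cornerSet.2 hv) (hL (midpoint_mem_carrier e)))
  rintro p hp N (rfl | rfl) hN
  exacts [connectedComponentIn_subset _ _ hp (Or.inl hN),
    connectedComponentIn_subset _ _ hp (Or.inr hN)]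

/-! ### Orientations of hyperplanes -/

theorem orientedDual_rev_congr {a b : X.Cube 1} (h : orientedDual a = orientedDual b) :
    orientedDual (rev a) = orientedDual (rev b) :=
  congrArg (Quot.map rev fun _ _ => ElemParallel.rev) h

theorem orientedDual_rev_comm {a b : X.Cube 1} (h : orientedDual (rev a) = orientedDual b) :
    orientedDual a = orientedDual (rev b) := by
  rw [← orientedDual_rev_congr h, rev_rev]

theorem init_rev (e : X.Cube 1) : init (rev e) = term e := by
  rw [init, rev, ← X.face_comp, FaceMap.comp_vertex]
  simp only [FaceMap.flip, Option.elim, mul_neg, mul_one, neg_neg]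
  rfl

theorem term_rev (e : X.Cube 1) : term (rev e) = init e := by
  rw [← init_rev, rev_rev]

theorem dual_rev (e : X.Cube 1) : dual (rev e) = dual e := (Quot.sound
  (r := fun a b : X.Cube 1 => ElemParallel a b ∨ b = rev a) (Or.inr rfl)).symm

theorem dual_eq_of_orientedDual_eq {a b : X.Cube 1} (h : orientedDual a = orientedDual b) :
    dual a = dual b :=
  congrArg OrientedHyperplane.forget h

theorem orientedDual_eq_or_of_dual_eq {a b : X.Cube 1} (h : dual a = dual b) :
    orientedDual a = orientedDual b ∨ orientedDual (rev a) = orientedDual b := by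
  have H := Quot.eqvGen_exact h
  clear h
  induction H with
  | rel a b h =>
    rcases h with h | rfl
    exacts [Or.inl (Quot.sound h), Or.inr rfl]
  | refl => exact Or.inl rfl
  | symm a b _ ih =>
    rcases ih with ih | ih
    exacts [Or.inl ih.symm, Or.inr (orientedDual_rev_comm ih).symm]
  | trans a b c _ _ ih₁ ih₂ =>
    rcases ih₁ with ih₁ | ih₁ <;> rcases ih₂ with ih₂ | ih₂
    · exact Or.inl (ih₁.trans ih₂)
    · exact Or.inr ((orientedDual_rev_congr ih₁).trans ih₂)
    · exact Or.inr (ih₁.trans ih₂)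
    · exact Or.inl ((orientedDual_rev_comm ih₁).trans ih₂)

theorem eq_or_of_dual_eq_forget {e : X.Cube 1} {E : X.OrientedHyperplane}
    (h : dual e = E.forget) : orientedDual e = E ∨ orientedDual (rev e) = E := by
  obtain ⟨a, rfl⟩ := Quot.exists_rep E
  exact orientedDual_eq_or_of_dual_eq h

theorem exists_orientedDual_eq (E : X.OrientedHyperplane) : ∃ e, orientedDual e = E :=
  Quot.exists_rep E

theorem edgeSign_of_eq (hX : X.IsSpecial) {E : X.OrientedHyperplane} {e : X.Cube 1}
    (h : orientedDual e = E) : edgeSign E e = 1 := by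
  subst h
  simp [edgeSign, (hX.two_sided e).symm]

theorem edgeSign_of_rev_eq (hX : X.IsSpecial) {E : X.OrientedHyperplane} {e : X.Cube 1}
    (h : orientedDual (rev e) = E) : edgeSign E e = -1 := by
  rw [← rev_rev e, edgeSign_rev, edgeSign_of_eq hX h]

theorem edgeSign_of_ne {E : X.OrientedHyperplane} {e : X.Cube 1} (h : dual e ≠ E.forget) :
    edgeSign E e = 0 := by
  have h1 : orientedDual e ≠ E := fun h' => h (congrArg OrientedHyperplane.forget h')
  have h2 : orientedDual (rev e) ≠ E := fun h' =>
    h ((dual_rev e).symm.trans (congrArg OrientedHyperplane.forget h'))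
  simp [edgeSign, h1, h2]

theorem edgeSign_orientedDual_rev (a e : X.Cube 1) :
    edgeSign (orientedDual (rev a)) e = -edgeSign (orientedDual a) e := by
  have h1 : orientedDual e = orientedDual (rev a) ↔ orientedDual (rev e) = orientedDual a :=
    ⟨fun h => (orientedDual_rev_comm h.symm).symm, fun h => orientedDual_rev_comm h⟩
  have h2 : orientedDual (rev e) = orientedDual (rev a) ↔ orientedDual e = orientedDual a :=
    ⟨fun h => by simpa only [rev_rev] using orientedDual_rev_congr h, orientedDual_rev_congr⟩
  rw [edgeSign, edgeSign, propext h1, propext h2]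
  ring

/-! ### Edges on one side of a hyperplane -/

/-- Two distinct hyperplanes with a common point. -/
def Crosses (K M : X.Hyperplane) : Prop := K ≠ M ∧ (K.carrier ∩ M.carrier).Nonempty

theorem crosses_of_corner (hX : X.IsSpecial) {a b : X.Cube 1} (h : Corner a b) :
    Crosses (dual a) (dual b) := by
  refine ⟨hX.no_self_intersection a b h, ?_⟩
  obtain ⟨x, rfl, rfl⟩ := h
  exact ⟨point x ⟨0, by simp, by simp⟩, ⟨2, x, 0, _, rfl, rfl, rfl⟩, ⟨2, x, 1, _, rfl, rfl, rfl⟩⟩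

/-- Along either side of an oriented hyperplane `E`, given by the initial (`u = -1`) or the terminal
(`u = 1`) vertices of its edges, a function on the vertices is constant if it does not change along
edges dual to hyperplanes crossing `E`. -/
theorem endpoint_eq_of_orientedDual_eq (hX : X.IsSpecial) {γ : Type*} (g : X.Cube 0 → γ) (u : ℤˣ)
    {E : X.OrientedHyperplane}
    (hg : ∀ e c : X.Cube 1, orientedDual e = E → Crosses (dual e) (dual c) →
      init c = X.face (FaceMap.vertex fun _ => u) e → g (init c) = g (term c))
    {a b : X.Cube 1} (ha : orientedDual a = E) (hb : orientedDual b = E) :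
    g (X.face (FaceMap.vertex fun _ => u) a) = g (X.face (FaceMap.vertex fun _ => u) b) := by
  have hab := Quot.eqvGen_exact (ha.trans hb.symm)
  clear hb
  induction hab with
  | rel a b h =>
    obtain ⟨x, rfl, rfl⟩ := h
    have hc : Corner (X.face (FaceMap.edge 0 (-1)) x) (X.face (FaceMap.edge 1 (-1)) x) :=
      ⟨x, rfl, rfl⟩
    have hcross : Crosses (dual (X.face (FaceMap.edge 0 (-1)) x))
        (dual (X.face (FaceMap.edge 1 u) x)) := by
      rw [← FaceMap.edgeAt_const 1 u, dual_face_edgeAt]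
      exact crosses_of_corner hX hc
    have hv : ∀ δ : ℤˣ, X.face (FaceMap.vertex fun _ => δ) (X.face (FaceMap.edge 1 u) x) =
        X.face (FaceMap.vertex fun _ => u) (X.face (FaceMap.edge 0 δ) x) := by
      intro δ
      rw [← X.face_comp, ← X.face_comp, ← FaceMap.edgeAt_const, ← FaceMap.edgeAt_const,
        FaceMap.edgeAt_comp_vertex, FaceMap.edgeAt_comp_vertex]
      congr 2
      funext j
      fin_cases j <;> simp
    have := hg _ _ ha hcross (hv (-1))
    rwa [init, term, hv, hv] at this
  | refl => rfl
  | symm a b hab ih =>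
    exact (ih (Eq.trans (Quot.eqvGen_sound hab) ha)).symm
  | trans a b c hab _ ih₁ ih₂ =>
    exact (ih₁ ha).trans (ih₂ (Eq.trans (Quot.eqvGen_sound hab).symm ha))

theorem init_eq_of_orientedDual_eq (hX : X.IsSpecial) {γ : Type*} (g : X.Cube 0 → γ)
    {E : X.OrientedHyperplane}
    (hg : ∀ e c : X.Cube 1, orientedDual e = E → Crosses (dual e) (dual c) →
      init c = init e → g (init c) = g (term c))
    {a b : X.Cube 1} (ha : orientedDual a = E) (hb : orientedDual b = E) :
    g (init a) = g (init b) :=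
  endpoint_eq_of_orientedDual_eq hX g (-1) hg ha hb

theorem term_eq_of_orientedDual_eq (hX : X.IsSpecial) {γ : Type*} (g : X.Cube 0 → γ)
    {E : X.OrientedHyperplane}
    (hg : ∀ e c : X.Cube 1, orientedDual e = E → Crosses (dual e) (dual c) →
      init c = term e → g (init c) = g (term c))
    {a b : X.Cube 1} (ha : orientedDual a = E) (hb : orientedDual b = E) :
    g (term a) = g (term b) :=
  endpoint_eq_of_orientedDual_eq hX g 1 hg ha hb

/-! ### Cocycles that vanish on cycles -/

/-- A homomorphism on `1`-chains that vanishes on all cycles is a coboundary: its potential at a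
vertex is the value on a chain from a chosen base point of the component to this vertex. -/
theorem exists_eq_sub_of_forall_ker (φ : (X.Cube 1 →₀ ℤ) →ₗ[ℤ] ℤ)
    (h : ∀ c ∈ LinearMap.ker X.boundaryOne, φ c = 0) :
    ∃ g : X.Cube 0 → ℤ, ∀ e, φ (Finsupp.single e 1) = g (term e) - g (init e) := by
  let s : Setoid (X.Cube 0) :=
    { r := fun v w => ∃ c, X.boundaryOne c = Finsupp.single w 1 - Finsupp.single v 1
      iseqv :=
        ⟨fun v => ⟨0, by simp⟩, fun ⟨c, hc⟩ => ⟨-c, by rw [map_neg, hc]; abel⟩,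
          fun ⟨c, hc⟩ ⟨d, hd⟩ => ⟨c + d, by rw [map_add, hc, hd]; abel⟩⟩ }
  have hb : ∀ e : X.Cube 1, X.boundaryOne (Finsupp.single e 1) =
      Finsupp.single (term e) 1 - Finsupp.single (init e) 1 := by
    intro e
    simp [boundaryOne]
  let root : X.Cube 0 → X.Cube 0 := fun v => (Quotient.mk s v).out
  have hroot : ∀ v, ∃ c, X.boundaryOne c = Finsupp.single v 1 - Finsupp.single (root v) 1 :=
    fun v => Quotient.exact (s := s) (Quotient.out_eq _)
  choose c hc using hroot
  refine ⟨fun v => φ (c v), fun e => ?_⟩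
  have hr : root (term e) = root (init e) := by
    have : Quotient.mk s (init e) = Quotient.mk s (term e) := Quotient.sound ⟨_, hb e⟩
    simp only [root, this]
  have := h (Finsupp.single e 1 - (c (term e) - c (init e))) (by
    rw [LinearMap.mem_ker, map_sub, map_sub, hb, hc, hc, hr]
    abel)
  rw [map_sub, map_sub, sub_eq_zero] at this
  exact this

theorem eq_zero_of_forall_eq_sub (φ : (X.Cube 1 →₀ ℤ) →ₗ[ℤ] ℤ) (g : X.Cube 0 → ℤ)
    (h : ∀ e, φ (Finsupp.single e 1) = g (term e) - g (init e)) (c : X.Cube 1 →₀ ℤ)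
    (hc : c ∈ LinearMap.ker X.boundaryOne) : φ c = 0 := by
  have : φ = Finsupp.linearCombination ℤ g ∘ₗ X.boundaryOne := by
    refine Finsupp.lhom_ext' fun e => LinearMap.ext_ring ?_
    simp [h, boundaryOne]
  rw [this, LinearMap.comp_apply, LinearMap.mem_ker.1 hc, map_zero]

theorem intersection_mk (E : X.OrientedHyperplane) (c : LinearMap.ker X.boundaryOne) :
    intersection E (Submodule.Quotient.mk c) = cochain E c :=
  rfl

theorem cochain_single (E : X.OrientedHyperplane) (e : X.Cube 1) :
    cochain E (Finsupp.single e 1) = edgeSign E e := by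
  simp [cochain]

theorem intersection_eq_iff {E F : X.OrientedHyperplane} : intersection E = intersection F ↔
    ∃ g : X.Cube 0 → ℤ, ∀ e, edgeSign E e - edgeSign F e = g (term e) - g (init e) := by
  constructor
  · intro h
    obtain ⟨g, hg⟩ := exists_eq_sub_of_forall_ker (cochain E - cochain F) fun c hc => by
      have := LinearMap.congr_fun h (Submodule.Quotient.mk ⟨c, hc⟩)
      rw [intersection_mk, intersection_mk] at this
      exact sub_eq_zero.2 this
    exact ⟨g, fun e => by rw [← hg, LinearMap.sub_apply, cochain_single, cochain_single]⟩
  · rintro ⟨g, hg⟩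
    refine LinearMap.ext fun α => ?_
    obtain ⟨c, rfl⟩ := Submodule.Quotient.mk_surjective _ α
    rw [intersection_mk, intersection_mk, ← sub_eq_zero]
    exact eq_zero_of_forall_eq_sub (cochain E - cochain F) g
      (fun e => by rw [← hg, LinearMap.sub_apply, cochain_single, cochain_single]) c c.2

theorem intersection_eq_zero_iff {E : X.OrientedHyperplane} : intersection E = 0 ↔
    ∃ g : X.Cube 0 → ℤ, ∀ e, edgeSign E e = g (term e) - g (init e) := by
  constructor
  · intro h
    obtain ⟨g, hg⟩ := exists_eq_sub_of_forall_ker (cochain E) fun c hc => by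
      have := LinearMap.congr_fun h (Submodule.Quotient.mk ⟨c, hc⟩)
      rwa [intersection_mk] at this
    exact ⟨g, fun e => by rw [← hg, cochain_single]⟩
  · rintro ⟨g, hg⟩
    refine LinearMap.ext fun α => ?_
    obtain ⟨c, rfl⟩ := Submodule.Quotient.mk_surjective _ α
    exact eq_zero_of_forall_eq_sub (cochain E) g (fun e => by rw [← hg, cochain_single]) c c.2

theorem intersection_orientedDual_rev (a : X.Cube 1) :
    intersection (orientedDual (rev a)) = -intersection (orientedDual a) := by
  have h : cochain (orientedDual (rev a)) = -cochain (orientedDual a) := by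
    refine Finsupp.lhom_ext' fun e => LinearMap.ext_ring ?_
    simp only [LinearMap.comp_apply, Finsupp.lsingle_apply, LinearMap.neg_apply, cochain_single,
      edgeSign_orientedDual_rev]
  refine LinearMap.ext fun α => ?_
  obtain ⟨c, rfl⟩ := Submodule.Quotient.mk_surjective _ α
  rw [LinearMap.neg_apply, intersection_mk, intersection_mk, h, LinearMap.neg_apply]

/-- Distinct oriented hyperplanes with the same nonzero intersection numbers are not the two
orientations of one hyperplane. -/
theorem forget_ne_of_intersection_eq {E F : X.OrientedHyperplane} (h0 : intersection E ≠ 0)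
    (h : intersection F = intersection E) (hne : E ≠ F) : E.forget ≠ F.forget := by
  obtain ⟨a, rfl⟩ := exists_orientedDual_eq E
  intro hEF
  rcases eq_or_of_dual_eq_forget hEF with rfl | rfl
  · exact hne rfl
  · rw [intersection_orientedDual_rev] at h
    refine h0 (LinearMap.ext fun α => ?_)
    have : -intersection (orientedDual a) α = intersection (orientedDual a) α :=
      LinearMap.congr_fun h α
    rw [LinearMap.zero_apply]
    omega

/-! ### Action of an automorphism -/

namespace Automorphism

/-- The inverse automorphism. -/
def symm (f : X.Automorphism) : X.Automorphism where
  map := fun n => (f.map n).symm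
  map_face := fun φ x => by rw [Equiv.symm_apply_eq, f.map_face, Equiv.apply_symm_apply]

/-- The image of an oriented hyperplane. -/
def mapOriented (f : X.Automorphism) : X.OrientedHyperplane → X.OrientedHyperplane :=
  Quot.map (f.map 1) fun _ _ => f.elemParallel

theorem mapOriented_orientedDual (f : X.Automorphism) (e : X.Cube 1) :
    f.mapOriented (orientedDual e) = orientedDual (f.map 1 e) :=
  rfl

theorem mapHyperplane_dual (f : X.Automorphism) (e : X.Cube 1) :
    f.mapHyperplane (dual e) = dual (f.map 1 e) :=
  rfl

theorem forget_mapOriented (f : X.Automorphism) (E : X.OrientedHyperplane) :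
    (f.mapOriented E).forget = f.mapHyperplane E.forget := by
  obtain ⟨a, rfl⟩ := exists_orientedDual_eq E
  rfl

theorem symm_mapOriented (f : X.Automorphism) (E : X.OrientedHyperplane) :
    f.symm.mapOriented (f.mapOriented E) = E := by
  obtain ⟨a, rfl⟩ := exists_orientedDual_eq E
  exact congrArg orientedDual ((f.map 1).symm_apply_apply a)

theorem symm_mapHyperplane (f : X.Automorphism) (K : X.Hyperplane) :
    f.symm.mapHyperplane (f.mapHyperplane K) = K := by
  obtain ⟨a, rfl⟩ := Quot.exists_rep K
  exact congrArg dual ((f.map 1).symm_apply_apply a)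

theorem mapHyperplane_symm (f : X.Automorphism) (K : X.Hyperplane) :
    f.mapHyperplane (f.symm.mapHyperplane K) = K :=
  f.symm.symm_mapHyperplane K

theorem mapOriented_injective (f : X.Automorphism) : Function.Injective f.mapOriented :=
  Function.LeftInverse.injective f.symm_mapOriented

theorem map_rev (f : X.Automorphism) (e : X.Cube 1) : f.map 1 (rev e) = rev (f.map 1 e) :=
  f.map_face _ e

theorem map_init (f : X.Automorphism) (e : X.Cube 1) : f.map 0 (init e) = init (f.map 1 e) :=
  f.map_face _ e

theorem map_term (f : X.Automorphism) (e : X.Cube 1) : f.map 0 (term e) = term (f.map 1 e) :=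
  f.map_face _ e

theorem edgeSign_map (f : X.Automorphism) (E : X.OrientedHyperplane) (e : X.Cube 1) :
    edgeSign (f.mapOriented E) (f.map 1 e) = edgeSign E e := by
  rw [edgeSign, edgeSign, ← map_rev, ← mapOriented_orientedDual, ← mapOriented_orientedDual,
    f.mapOriented_injective.eq_iff, f.mapOriented_injective.eq_iff]

theorem intersection_mapOriented {f : X.Automorphism} (hf : f.mapH1 = LinearMap.id)
    (E : X.OrientedHyperplane) : intersection (f.mapOriented E) = intersection E := by
  have h : cochain (f.mapOriented E) ∘ₗ f.mapChain = cochain E := by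
    refine Finsupp.lhom_ext' fun e => LinearMap.ext_ring ?_
    simp [mapChain, cochain_single, edgeSign_map]
  refine LinearMap.ext fun α => ?_
  conv_lhs => rw [← LinearMap.id_apply (R := ℤ) α, ← hf]
  obtain ⟨c, rfl⟩ := Submodule.Quotient.mk_surjective _ α
  exact LinearMap.congr_fun h c

end Automorphism

/-! ### Regions bounded by one or two hyperplanes -/

/-- The coboundary of the set of vertices `A` is the oriented hyperplane `E`: the edges of `E` enter
`A`, and no other edges connect `A` with its complement. -/
structure Bounds (A : Set (X.Cube 0)) (E : X.OrientedHyperplane) : Prop where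
  init_notMem : ∀ e : X.Cube 1, orientedDual e = E → init e ∉ A
  term_mem : ∀ e : X.Cube 1, orientedDual e = E → term e ∈ A
  mem_iff : ∀ e : X.Cube 1, dual e ≠ E.forget → (init e ∈ A ↔ term e ∈ A)

/-- The set of vertices `A` is a region between the oriented hyperplanes `E` and `F`: the edges of
`E` enter `A`, those of `F` leave `A`, and no other edges connect `A` with its complement. -/
structure IsRegion (A : Set (X.Cube 0)) (E F : X.OrientedHyperplane) : Prop where
  init_notMem : ∀ e : X.Cube 1, orientedDual e = E → init e ∉ A
  term_mem : ∀ e : X.Cube 1, orientedDual e = E → term e ∈ A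
  init_mem : ∀ e : X.Cube 1, orientedDual e = F → init e ∈ A
  term_notMem : ∀ e : X.Cube 1, orientedDual e = F → term e ∉ A
  mem_iff : ∀ e : X.Cube 1, dual e ≠ E.forget → dual e ≠ F.forget → (init e ∈ A ↔ term e ∈ A)

theorem mem_iff_of_dual_eq_forget {B : Set (X.Cube 0)} {E : X.OrientedHyperplane}
    (h : ∀ e : X.Cube 1, orientedDual e = E → (init e ∈ B ↔ term e ∈ B)) {e : X.Cube 1}
    (he : dual e = E.forget) : init e ∈ B ↔ term e ∈ B := by
  rcases eq_or_of_dual_eq_forget he with he | he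
  · exact h e he
  · have := h _ he
    rw [init_rev, term_rev] at this
    exact this.symm

theorem Bounds.intersection_eq_zero (hX : X.IsSpecial) {A : Set (X.Cube 0)}
    {E : X.OrientedHyperplane} (h : Bounds A E) : intersection E = 0 := by
  classical
  refine intersection_eq_zero_iff.2 ⟨fun v => if v ∈ A then 1 else 0, fun e => ?_⟩
  beta_reduce
  by_cases he : dual e = E.forget
  · rcases eq_or_of_dual_eq_forget he with he | he
    · rw [edgeSign_of_eq hX he, if_pos (h.term_mem e he), if_neg (h.init_notMem e he)]
      rfl
    · have h1 := h.init_notMem _ he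
      have h2 := h.term_mem _ he
      rw [init_rev] at h1
      rw [term_rev] at h2
      rw [edgeSign_of_rev_eq hX he, if_pos h2, if_neg h1]
      rfl
  · rw [edgeSign_of_ne he, if_congr (h.mem_iff e he) rfl rfl, sub_self]

theorem IsRegion.intersection_eq (hX : X.IsSpecial) {A : Set (X.Cube 0)}
    {E F : X.OrientedHyperplane} (hEF : E.forget ≠ F.forget) (h : IsRegion A E F) :
    intersection E = intersection F := by
  classical
  refine intersection_eq_iff.2 ⟨fun v => if v ∈ A then 1 else 0, fun e => ?_⟩
  beta_reduce
  by_cases he : dual e = E.forget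
  · rw [edgeSign_of_ne (E := F) (he ▸ hEF)]
    rcases eq_or_of_dual_eq_forget he with he | he
    · rw [edgeSign_of_eq hX he, if_pos (h.term_mem e he), if_neg (h.init_notMem e he)]
    · have h1 := h.init_notMem _ he
      have h2 := h.term_mem _ he
      rw [init_rev] at h1
      rw [term_rev] at h2
      rw [edgeSign_of_rev_eq hX he, if_pos h2, if_neg h1]
      rfl
  by_cases he' : dual e = F.forget
  · rw [edgeSign_of_ne he]
    rcases eq_or_of_dual_eq_forget he' with he' | he'
    · rw [edgeSign_of_eq hX he', if_neg (h.term_notMem e he'), if_pos (h.init_mem e he')]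
    · have h1 := h.init_mem _ he'
      have h2 := h.term_notMem _ he'
      rw [init_rev] at h1
      rw [term_rev] at h2
      rw [edgeSign_of_rev_eq hX he', if_neg h2, if_pos h1]
      rfl
  · rw [edgeSign_of_ne he, edgeSign_of_ne he', if_congr (h.mem_iff e he he') rfl rfl, sub_self,
      sub_self]

/-- A hyperplane with vanishing intersection numbers separates the vertices: a potential of its
cocycle is constant on the initial vertices of its edges, and the region is a superlevel set. -/
theorem exists_bounds (hX : X.IsSpecial) {E : X.OrientedHyperplane} (h : intersection E = 0) :
    ∃ A, Bounds A E := by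
  obtain ⟨g, hg⟩ := intersection_eq_zero_iff.1 h
  obtain ⟨a, ha⟩ := exists_orientedDual_eq E
  have hinit : ∀ e, orientedDual e = E → g (init e) = g (init a) := by
    intro e he
    refine init_eq_of_orientedDual_eq hX g (fun e c he hc _ => ?_) he ha
    have hne : dual c ≠ E.forget := fun h => hc.1 (by rw [h, ← he]; rfl)
    have := hg c
    rw [edgeSign_of_ne hne] at this
    omega
  have hterm : ∀ e, orientedDual e = E → g (term e) = g (init a) + 1 := by
    intro e he
    have := hg e
    rw [edgeSign_of_eq hX he, hinit e he] at this
    omega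
  refine ⟨{v | g (init a) < g v}, fun e he => ?_, fun e he => ?_, fun e he => ?_⟩
  · simp [hinit e he]
  · simp [hterm e he]
  · have := hg e
    rw [edgeSign_of_ne he] at this
    simp [show g (term e) = g (init e) by omega]

/-- Two disjoint hyperplanes with the same nonzero intersection numbers bound a region. The
potential of the difference of their cocycles is constant along each of them, and unless its jumps
along `E` and `F` occur at the same level, `E` alone would bound a superlevel set. -/
theorem exists_isRegion (hX : X.IsSpecial) {E F : X.OrientedHyperplane} (h0 : intersection E ≠ 0)
    (h : intersection F = intersection E) (hne : E ≠ F) (hd : ¬ Crosses E.forget F.forget)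
    (hd' : ¬ Crosses F.forget E.forget) : ∃ A, IsRegion A E F := by
  have hEF := forget_ne_of_intersection_eq h0 h hne
  obtain ⟨g, hg⟩ := intersection_eq_iff.1 h.symm
  obtain ⟨a, ha⟩ := exists_orientedDual_eq E
  obtain ⟨b, hb⟩ := exists_orientedDual_eq F
  have hflat : ∀ e, dual e ≠ E.forget → dual e ≠ F.forget → g (init e) = g (term e) := by
    intro e h1 h2
    have := hg e
    rw [edgeSign_of_ne h1, edgeSign_of_ne h2] at this
    omega
  have hEinit : ∀ e, orientedDual e = E → g (init e) = g (init a) := by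
    intro e he
    refine init_eq_of_orientedDual_eq hX g (fun e c he hc _ => ?_) he ha
    subst he
    exact hflat c (fun h => hc.1 h.symm) fun h => hd (h ▸ hc)
  have hEterm : ∀ e, orientedDual e = E → g (term e) = g (init a) + 1 := by
    intro e he
    have := hg e
    rw [edgeSign_of_eq hX he, hEinit e he,
      edgeSign_of_ne (E := F) (by rw [← he] at hEF; exact hEF)] at this
    omega
  have hFinit : ∀ e, orientedDual e = F → g (init e) = g (init b) := by
    intro e he
    refine init_eq_of_orientedDual_eq hX g (fun e c he hc _ => ?_) he hb
    subst he
    exact hflat c (fun h => hd' (h ▸ hc)) fun h => hc.1 h.symm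
  have hFterm : ∀ e, orientedDual e = F → g (term e) = g (init b) - 1 := by
    intro e he
    have := hg e
    rw [edgeSign_of_eq hX he, hFinit e he,
      edgeSign_of_ne (E := E) (by rw [← he] at hEF; exact hEF.symm)] at this
    omega
  by_cases hlevel : g (init b) = g (init a) + 1
  · refine ⟨{v | g (init a) < g v}, fun e he => ?_, fun e he => ?_, fun e he => ?_, fun e he => ?_,
      fun e h1 h2 => ?_⟩
    · simp [hEinit e he]
    · simp [hEterm e he]
    · simp [hFinit e he, hlevel]
    · simp [hFterm e he, hlevel]
    · simp [hflat e h1 h2]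
  · refine absurd (Bounds.intersection_eq_zero hX (A := {v | g (init a) < g v})
      ⟨fun e he => ?_, fun e he => ?_, fun e h1 => ?_⟩) h0
    · simp [hEinit e he]
    · simp [hEterm e he]
    · by_cases h2 : dual e = F.forget
      · refine mem_iff_of_dual_eq_forget (fun e he => ?_) h2
        simp only [Set.mem_ofPred_eq, hFinit e he, hFterm e he]
        omega
      · simp [hflat e h1 h2]

theorem Bounds.compl_rev {A : Set (X.Cube 0)} {a : X.Cube 1} (h : Bounds A (orientedDual a)) :
    Bounds Aᶜ (orientedDual (rev a)) := by
  refine ⟨fun e he => ?_, fun e he => ?_, fun e he => ?_⟩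
  · have := h.term_mem (rev e) (orientedDual_rev_comm he.symm).symm
    rw [term_rev] at this
    exact not_not.2 this
  · have := h.init_notMem (rev e) (orientedDual_rev_comm he.symm).symm
    rwa [init_rev] at this
  · rw [forget_orientedDual, dual_rev] at he
    exact not_congr (h.mem_iff e he)

/-! ### Images of regions under an automorphism -/

namespace Automorphism

/-- The image of a set of vertices. -/
def mapSet (f : X.Automorphism) (A : Set (X.Cube 0)) : Set (X.Cube 0) := f.symm.map 0 ⁻¹' A

theorem init_mem_mapSet {f : X.Automorphism} {A : Set (X.Cube 0)} {e : X.Cube 1} :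
    init e ∈ f.mapSet A ↔ init (f.symm.map 1 e) ∈ A := by
  rw [mapSet, Set.mem_preimage, map_init]

theorem term_mem_mapSet {f : X.Automorphism} {A : Set (X.Cube 0)} {e : X.Cube 1} :
    term e ∈ f.mapSet A ↔ term (f.symm.map 1 e) ∈ A := by
  rw [mapSet, Set.mem_preimage, map_term]

theorem ncard_mapSet (f : X.Automorphism) (A : Set (X.Cube 0)) : (f.mapSet A).ncard = A.ncard := by
  have : f.mapSet A = f.map 0 '' A := ((f.map 0).image_eq_preimage_symm A).symm
  rw [this, Set.ncard_image_of_injective _ (f.map 0).injective]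

theorem orientedDual_symm_map {f : X.Automorphism} {E : X.OrientedHyperplane} {e : X.Cube 1}
    (h : orientedDual e = f.mapOriented E) : orientedDual (f.symm.map 1 e) = E := by
  rw [← mapOriented_orientedDual, h, symm_mapOriented]

theorem dual_symm_map_iff {f : X.Automorphism} {K : X.Hyperplane} {e : X.Cube 1} :
    dual (f.symm.map 1 e) = K ↔ dual e = f.mapHyperplane K := by
  rw [← mapHyperplane_dual]
  refine ⟨fun h => by rw [← h, mapHyperplane_symm], fun h => by rw [h, symm_mapHyperplane]⟩

end Automorphism

theorem Bounds.map {A : Set (X.Cube 0)} {E : X.OrientedHyperplane} (h : Bounds A E)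
    (f : X.Automorphism) : Bounds (f.mapSet A) (f.mapOriented E) := by
  refine ⟨fun e he => ?_, fun e he => ?_, fun e he => ?_⟩
  · rw [Automorphism.init_mem_mapSet]
    exact h.init_notMem _ (Automorphism.orientedDual_symm_map he)
  · rw [Automorphism.term_mem_mapSet]
    exact h.term_mem _ (Automorphism.orientedDual_symm_map he)
  · rw [Automorphism.init_mem_mapSet, Automorphism.term_mem_mapSet]
    rw [Automorphism.forget_mapOriented] at he
    exact h.mem_iff _ fun h' => he (Automorphism.dual_symm_map_iff.1 h')

theorem IsRegion.map {A : Set (X.Cube 0)} {E F : X.OrientedHyperplane} (h : IsRegion A E F)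
    (f : X.Automorphism) : IsRegion (f.mapSet A) (f.mapOriented E) (f.mapOriented F) := by
  refine ⟨fun e he => ?_, fun e he => ?_, fun e he => ?_, fun e he => ?_, fun e he he' => ?_⟩
  · rw [Automorphism.init_mem_mapSet]
    exact h.init_notMem _ (Automorphism.orientedDual_symm_map he)
  · rw [Automorphism.term_mem_mapSet]
    exact h.term_mem _ (Automorphism.orientedDual_symm_map he)
  · rw [Automorphism.init_mem_mapSet]
    exact h.init_mem _ (Automorphism.orientedDual_symm_map he)
  · rw [Automorphism.term_mem_mapSet]
    exact h.term_notMem _ (Automorphism.orientedDual_symm_map he)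
  · rw [Automorphism.init_mem_mapSet, Automorphism.term_mem_mapSet]
    rw [Automorphism.forget_mapOriented] at he he'
    exact h.mem_iff _ (fun h' => he (Automorphism.dual_symm_map_iff.1 h'))
      fun h' => he' (Automorphism.dual_symm_map_iff.1 h')

/-! ### Nonseparating hyperplanes -/

/-- The edges not dual to `L` connect all vertices: a set of vertices that is connected with its
complement only by edges dual to `L` is empty or consists of all vertices. -/
def NonSeparating (L : X.Hyperplane) : Prop :=
  ∀ W : Set (X.Cube 0), ClosedOff {L} W → ∀ v ∈ W, ∀ w, w ∈ W

theorem NonSeparating.mem_of_forall {L : X.Hyperplane} (hL : NonSeparating L) {B : Set (X.Cube 0)}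
    (hB : ∀ e : X.Cube 1, init e ∈ B ↔ term e ∈ B) {v : X.Cube 0} (hv : v ∈ B) (w : X.Cube 0) :
    w ∈ B :=
  hL B (fun e _ => hB e) v hv w

theorem NonSeparating.intersection_ne_zero (hX : X.IsSpecial) {l : X.Cube 1}
    (hl : NonSeparating (dual l)) : intersection (orientedDual l) ≠ 0 := by
  intro h
  obtain ⟨A, hA⟩ := exists_bounds hX h
  exact hA.init_notMem l rfl (hl A (fun e he => hA.mem_iff e he) _ (hA.term_mem l rfl) _)

/-- The hypotheses on `X` and on the automorphism `f` which the argument uses, expressed by sets of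
vertices: `f` preserves intersection numbers, hyperplanes with equal intersection numbers do not
cross, and every region cut off by two such hyperplanes contains a nonseparating hyperplane disjoint
from them. -/
structure CombinatorialHypotheses (f : X.Automorphism) : Prop where
  special : X.IsSpecial
  finite : Finite (X.Cube 0)
  intersection_map : ∀ E : X.OrientedHyperplane, intersection (f.mapOriented E) = intersection E
  not_crosses : ∀ E F : X.OrientedHyperplane, intersection E = intersection F →
    ¬ Crosses E.forget F.forget
  exists_nonSeparating : ∀ E F : X.OrientedHyperplane, E.forget ≠ F.forget →
    intersection E = intersection F → ∀ A : Set (X.Cube 0), ClosedOff {E.forget, F.forget} A →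
    ∀ v ∈ A, ∀ w, w ∉ A → ∃ l : X.Cube 1, NonSeparating (dual l) ∧
      (∀ e, dual e = dual l → init e ∈ A ∧ term e ∈ A) ∧
      ¬ Crosses E.forget (dual l) ∧ ¬ Crosses F.forget (dual l)

namespace CombinatorialHypotheses

variable {f : X.Automorphism}

/-- A nonseparating hyperplane in `A` whose image under `f` lies outside `A` bounds a region
together with its image. -/
theorem exists_isRegion_map (hf : CombinatorialHypotheses f) {A : Set (X.Cube 0)} {l : X.Cube 1}
    (hl : NonSeparating (dual l)) (hlA : ∀ e, dual e = dual l → init e ∈ A ∧ term e ∈ A)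
    (hlA' : ∀ e, dual e = dual (f.map 1 l) → init e ∉ A) :
    ∃ T, IsRegion T (orientedDual l) (orientedDual (f.map 1 l)) := by
  have h : intersection (orientedDual (f.map 1 l)) = intersection (orientedDual l) :=
    hf.intersection_map (orientedDual l)
  exact exists_isRegion hf.special (hl.intersection_ne_zero hf.special) h
    (fun h => hlA' _ rfl (hlA _ (dual_eq_of_orientedDual_eq h.symm)).1)
    (hf.not_crosses (orientedDual l) (orientedDual (f.map 1 l)) h.symm)
    (hf.not_crosses (orientedDual (f.map 1 l)) (orientedDual l) h)

/-- A hyperplane `E` bounding a set `P` of vertices cannot be moved by `f` to a different hyperplane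
outside `P`. The image `P'` of `P` has the same cardinality as `P`, hence does not contain it
properly, and so is disjoint from it. A nonseparating hyperplane in `P` and its image in `P'` bound
a region `T`; replacing `T` outside `P` by a constant exhibits the nonseparating hyperplane as
separating. -/
theorem false_of_bounds (hf : CombinatorialHypotheses f) {E : X.OrientedHyperplane}
    {P : Set (X.Cube 0)} (hP : Bounds P E) (hne : E.forget ≠ (f.mapOriented E).forget)
    (hout : ∀ e, orientedDual e = f.mapOriented E → init e ∉ P) : False := by
  have hX := hf.special
  have := hf.finite
  obtain ⟨a, rfl⟩ := exists_orientedDual_eq E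
  set E := orientedDual a
  have hP' := hP.map f
  set P' := f.mapSet P
  have hdisj : ¬ Crosses E.forget (f.mapOriented E).forget :=
    hf.not_crosses _ _ (hf.intersection_map E).symm
  have hout' : ∀ e, orientedDual e = f.mapOriented E → term e ∉ P := by
    intro e he
    rw [← hP.mem_iff e fun h => hne (h.symm.trans (congrArg OrientedHyperplane.forget he))]
    exact hout e he
  obtain ⟨l, hl, hlP, hlE, -⟩ := hf.exists_nonSeparating E (f.mapOriented E) hne
    (hf.intersection_map E).symm P (fun e he => hP.mem_iff e fun h => he (Or.inl h)) (term a)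
    (hP.term_mem a rfl) (init a) (hP.init_notMem a rfl)
  have hE' : ∀ e, orientedDual e = E → (init e ∈ P' ↔ term e ∈ P') := fun e he =>
    hP'.mem_iff e fun h => hne ((congrArg OrientedHyperplane.forget he).symm.trans h)
  have hEconst : ∀ e, orientedDual e = E → (init e ∈ P' ↔ init a ∈ P') := by
    intro e he
    refine iff_of_eq (init_eq_of_orientedDual_eq hX (· ∈ P') (fun e c he hc _ => ?_) he rfl)
    refine propext (hP'.mem_iff c fun h => hdisj ?_)
    rw [← h, ← he]
    exact hc
  by_cases ha : init a ∈ P'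
  · -- `P` is a proper subset of `P'`
    have hsub : P ⊆ P' := by
      intro v hv
      by_contra hv'
      refine hP.init_notMem a rfl (hl.mem_of_forall (B := P \ P') (fun e => ?_) ⟨hv, hv'⟩ _).1
      by_cases h1 : dual e = E.forget
      · refine mem_iff_of_dual_eq_forget (fun e he => ?_) h1
        have := (hEconst e he).2 ha
        have := (hE' e he).1 this
        simp [*]
      by_cases h2 : dual e = (f.mapOriented E).forget
      · refine mem_iff_of_dual_eq_forget (fun e he => ?_) h2
        simp [hout e he, hout' e he]
      · simp [hP.mem_iff e h1, hP'.mem_iff e h2]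
    have hlt := Set.ncard_lt_ncard
      ⟨hsub, fun h => hP.init_notMem a rfl (h ha)⟩
    rw [f.ncard_mapSet] at hlt
    exact lt_irrefl _ hlt
  · have hPP' : ∀ v, v ∈ P → v ∉ P' := by
      intro v hv hv'
      refine hP.init_notMem a rfl (hl.mem_of_forall (B := P ∩ P') (fun e => ?_) ⟨hv, hv'⟩ _).1
      by_cases h1 : dual e = E.forget
      · refine mem_iff_of_dual_eq_forget (fun e he => ?_) h1
        have h := mt (hEconst e he).1 ha
        have := mt (hE' e he).2 h
        simp [*]
      by_cases h2 : dual e = (f.mapOriented E).forget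
      · refine mem_iff_of_dual_eq_forget (fun e he => ?_) h2
        simp [hout e he, hout' e he]
      · simp [hP.mem_iff e h1, hP'.mem_iff e h2]
    have hlP' : ∀ e, dual e = dual (f.map 1 l) → init e ∉ P := by
      intro e he h
      refine hPP' _ h (Automorphism.init_mem_mapSet.2 (hlP _ ?_).1)
      exact Automorphism.dual_symm_map_iff.2 he
    obtain ⟨T, hT⟩ := hf.exists_isRegion_map hl hlP hlP'
    have hTP : ∀ e, init e ∈ P → dual e ≠ dual l → (init e ∈ T ↔ term e ∈ T) :=
      fun e he hne => hT.mem_iff e hne fun h => hlP' e h he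
    have hTE : ∀ e, orientedDual e = E → (term e ∈ T ↔ term a ∈ T) := by
      intro e he
      refine iff_of_eq (term_eq_of_orientedDual_eq hX (· ∈ T) (fun e c he hc hce => ?_) he rfl)
      refine propext (hTP c (hce ▸ hP.term_mem e he) fun h => hlE ?_)
      rw [← h, ← he]
      exact hc
    have key := hl {v | (v ∈ P → v ∈ T) ∧ (v ∉ P → term a ∈ T)} (fun e he => ?_) (term l)
      (by simp [hlP l rfl, hT.term_mem l rfl]) (init l)
    · exact hT.init_notMem l rfl (key.1 (hlP l rfl).1)
    by_cases h1 : dual e = E.forget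
    · refine mem_iff_of_dual_eq_forget (fun e he => ?_) h1
      simp [hP.init_notMem e he, hP.term_mem e he, hTE e he]
    · have h2 := hP.mem_iff e h1
      by_cases h3 : init e ∈ P
      · simp [h3, h2.1 h3, hTP e h3 he]
      · simp [h3, mt h2.2 h3]

/-- `f` fixes every hyperplane whose intersection numbers vanish. -/
theorem forget_mapOriented_of_intersection_eq_zero (hf : CombinatorialHypotheses f)
    {E : X.OrientedHyperplane} (h0 : intersection E = 0) :
    E.forget = (f.mapOriented E).forget := by
  by_contra hne
  have hX := hf.special
  obtain ⟨A, hA⟩ := exists_bounds hX h0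
  obtain ⟨a, rfl⟩ := exists_orientedDual_eq E
  have hconst : ∀ e, orientedDual e = f.mapOriented (orientedDual a) →
      (init e ∈ A ↔ init (f.map 1 a) ∈ A) := by
    intro e he
    refine iff_of_eq (init_eq_of_orientedDual_eq hX (· ∈ A) (fun e c he hc _ => ?_) he rfl)
    refine propext (hA.mem_iff c fun h =>
      hf.not_crosses _ _ (hf.intersection_map (orientedDual a)) ?_)
    rw [← h, ← he]
    exact hc
  by_cases ha : init (f.map 1 a) ∈ A
  · -- the reverse orientation bounds the complement, which does not contain the image
    refine hf.false_of_bounds hA.compl_rev ?_ fun e he => not_not.2 ?_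
    · rw [Automorphism.forget_mapOriented] at hne ⊢
      rwa [forget_orientedDual, dual_rev]
    · rw [Automorphism.mapOriented_orientedDual, Automorphism.map_rev] at he
      have he' : orientedDual (rev e) = orientedDual (f.map 1 a) :=
        (orientedDual_rev_comm he.symm).symm
      rw [← term_rev, ← hA.mem_iff (rev e) fun h => hne ?_]
      · exact (hconst _ he').2 ha
      · rw [← h]
        exact congrArg OrientedHyperplane.forget he'
  · exact hf.false_of_bounds hA hne fun e he => mt (hconst e he).1 ha

/-- If `E` is not the only oriented hyperplane with its intersection numbers, then a region between
`E` and another one that has the least number of vertices contains no hyperplane with these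
intersection numbers: such a hyperplane would cut off a smaller region. -/
theorem exists_isRegion_minimal (hf : CombinatorialHypotheses f) {E F₀ : X.OrientedHyperplane}
    (h0 : intersection E ≠ 0) (hF₀ : intersection F₀ = intersection E) (hne : E ≠ F₀) :
    ∃ F A, intersection F = intersection E ∧ E ≠ F ∧ IsRegion A E F ∧
      ∀ G, intersection G = intersection E → G ≠ E → G ≠ F →
        ∀ e, orientedDual e = G → init e ∉ A ∧ term e ∉ A := by
  classical
  have hX := hf.special
  have := hf.finite
  have hforget : ∀ {F G}, intersection F = intersection E → intersection G = intersection E →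
      F ≠ G → F.forget ≠ G.forget := fun hF hG h =>
    forget_ne_of_intersection_eq (hF.symm ▸ h0) (hG.trans hF.symm) h
  have hex : ∀ F, intersection F = intersection E → E ≠ F → ∃ A, IsRegion A E F :=
    fun F hF h => exists_isRegion hX h0 hF h (hf.not_crosses _ _ hF.symm) (hf.not_crosses _ _ hF)
  have hS : ∃ n, ∃ F A,
      intersection F = intersection E ∧ E ≠ F ∧ IsRegion A E F ∧ A.ncard = n := by
    obtain ⟨A, hA⟩ := hex F₀ hF₀ hne
    exact ⟨_, F₀, A, hF₀, hne, hA, rfl⟩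
  obtain ⟨F, A, hF, hEF, hA, hcard⟩ := Nat.find_spec hS
  refine ⟨F, A, hF, hEF, hA, fun G hG hGE hGF e he => ?_⟩
  have hiff : ∀ e, orientedDual e = G → (init e ∈ A ↔ term e ∈ A) := by
    rintro e rfl
    exact hA.mem_iff e (hforget hG rfl hGE) (hforget hG hF hGF)
  suffices init e ∉ A from ⟨this, mt (hiff e he).2 this⟩
  intro heA
  -- all of `G` lies in `A`, and the region `B` between `E` and `G` makes `A` smaller
  have hGA : ∀ c, orientedDual c = G → init c ∈ A := by
    intro c hc
    have := init_eq_of_orientedDual_eq hX (· ∈ A) (fun e' c' he' hc' _ => ?_) hc he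
    · exact (iff_of_eq this).2 heA
    subst he'
    refine propext (hA.mem_iff c' (fun h => ?_) fun h => ?_)
    · exact hf.not_crosses _ _ hG (h ▸ hc')
    · exact hf.not_crosses _ _ (hG.trans hF.symm) (h ▸ hc')
  obtain ⟨B, hB⟩ := hex G hG hGE.symm
  have hFB : ∀ c, orientedDual c = F → (init c ∈ B ↔ term c ∈ B) := by
    rintro c rfl
    exact hB.mem_iff c (hforget hF rfl hEF.symm) (hforget hF hG hGF.symm)
  obtain ⟨b, hb⟩ := exists_orientedDual_eq F
  have hFconst : ∀ c, orientedDual c = F → (init c ∈ B ↔ init b ∈ B) := by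
    intro c hc
    refine iff_of_eq (init_eq_of_orientedDual_eq hX (· ∈ B) (fun e' c' he' hc' _ => ?_) hc hb)
    subst he'
    refine propext (hB.mem_iff c' (fun h => ?_) fun h => ?_)
    · exact hf.not_crosses _ _ hF (h ▸ hc')
    · exact hf.not_crosses _ _ (hF.trans hG.symm) (h ▸ hc')
  by_cases hbB : init b ∈ B
  · -- impossible, since then `G` alone bounds `A \ B`
    refine h0 (hG ▸ Bounds.intersection_eq_zero hX (A := A \ B) ⟨fun c hc => ?_, fun c hc => ?_,
      fun c hc => ?_⟩)
    · simp [hB.init_mem c hc]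
    · simp [hB.term_notMem c hc, (hiff c hc).1 (hGA c hc)]
    by_cases h1 : dual c = E.forget
    · refine mem_iff_of_dual_eq_forget (fun c hc => ?_) h1
      simp [hA.init_notMem c hc, hB.term_mem c hc]
    by_cases h2 : dual c = F.forget
    · refine mem_iff_of_dual_eq_forget (fun c hc => ?_) h2
      have h3 := (hFconst c hc).2 hbB
      simp [h3, (hFB c hc).1 h3]
    · simp [hA.mem_iff c h1 h2, hB.mem_iff c h1 hc]
  · have hreg : IsRegion (A ∩ B) E G := by
      refine ⟨fun c hc => ?_, fun c hc => ?_, fun c hc => ?_, fun c hc => ?_, fun c h1 hc => ?_⟩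
      · simp [hA.init_notMem c hc]
      · simp [hA.term_mem c hc, hB.term_mem c hc]
      · simp [hGA c hc, hB.init_mem c hc]
      · simp [hB.term_notMem c hc]
      by_cases h2 : dual c = F.forget
      · refine mem_iff_of_dual_eq_forget (fun c hc => ?_) h2
        have h3 := mt (hFconst c hc).1 hbB
        simp [h3, mt (hFB c hc).2 h3]
      · simp [hA.mem_iff c h1 h2, hB.mem_iff c h1 hc]
    have hlt : (A ∩ B).ncard < A.ncard := Set.ncard_lt_ncard
      ⟨Set.inter_subset_left, fun h =>
        hB.term_notMem e he (h ((hiff e he).1 heA)).2⟩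
    rw [hcard] at hlt
    exact Nat.find_min hS hlt ⟨G, _, hG, hGE.symm, hreg, rfl⟩

/-- `f` fixes every oriented hyperplane with a nonzero intersection number. Otherwise a minimal
region `A` on one side of the hyperplane is disjoint from its image; a nonseparating hyperplane in
`A` and its image bound a region `T`, and `A ∩ T` shows that the nonseparating hyperplane separates,
or that one of its orientations has the same intersection numbers as `E`, which contradicts
minimality. -/
theorem mapOriented_eq_of_intersection_ne_zero (hf : CombinatorialHypotheses f)
    {E : X.OrientedHyperplane} (h0 : intersection E ≠ 0) : f.mapOriented E = E := by
  by_contra hne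
  have hX := hf.special
  obtain ⟨F, A, hF, hEF, hA, hmin⟩ :=
    hf.exists_isRegion_minimal h0 (hf.intersection_map E) (Ne.symm hne)
  have hforget : ∀ {F G}, intersection F = intersection E → intersection G = intersection E →
      F ≠ G → F.forget ≠ G.forget := fun hF hG h =>
    forget_ne_of_intersection_eq (hF.symm ▸ h0) (hG.trans hF.symm) h
  have hfE := hf.intersection_map E
  have hfF := (hf.intersection_map F).trans hF
  have hA' := hA.map f
  obtain ⟨a, ha⟩ := exists_orientedDual_eq E
  obtain ⟨b, hb⟩ := exists_orientedDual_eq F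
  obtain ⟨l, hl, hlA, hlE, hlF⟩ := hf.exists_nonSeparating E F (hforget rfl hF hEF) hF.symm A
    (fun e he => hA.mem_iff e (fun h => he (Or.inl h)) fun h => he (Or.inr h)) (term a)
    (hA.term_mem a ha) (init a) (hA.init_notMem a ha)
  have hmin' : ∀ G, intersection G = intersection E → G ≠ f.mapOriented E → G ≠ f.mapOriented F →
      ∀ e, orientedDual e = G → init e ∉ f.mapSet A ∧ term e ∉ f.mapSet A := by
    rintro _ hG hGE hGF e rfl
    rw [Automorphism.init_mem_mapSet, Automorphism.term_mem_mapSet]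
    have he : f.mapOriented (orientedDual (f.symm.map 1 e)) = orientedDual e :=
      congrArg orientedDual ((f.map 1).apply_symm_apply e)
    refine hmin _ ?_ ?_ ?_ _ rfl
    · rw [← hf.intersection_map, he, hG]
    · intro h
      rw [h] at he
      exact hGE he.symm
    · intro h
      rw [h] at he
      exact hGF he.symm
  have hE : ∀ e, orientedDual e = E → term e ∉ f.mapSet A := by
    intro e he
    by_cases h : E = f.mapOriented F
    · exact hA'.term_notMem e (he.trans h)
    · exact (hmin' E rfl (Ne.symm hne) h e he).2
  have hfE' : ∀ e, orientedDual e = f.mapOriented E → term e ∉ A := by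
    intro e he
    by_cases h : f.mapOriented E = F
    · exact hA.term_notMem e (he.trans h)
    · exact (hmin _ hfE hne h e he).2
  have hFF : f.mapOriented F ≠ F := by
    -- otherwise `F` alone bounds the complement of `A ∩ f A`
    intro hFF
    rw [hFF] at hA'
    refine h0 (hF ▸ Bounds.intersection_eq_zero hX (A := (A ∩ f.mapSet A)ᶜ)
      ⟨fun c hc => ?_, fun c hc => ?_, fun c hc => ?_⟩)
    · simp [hA.init_mem c hc, hA'.init_mem c hc]
    · simp [hA.term_notMem c hc]
    refine not_congr ?_
    by_cases h1 : dual c = E.forget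
    · refine mem_iff_of_dual_eq_forget (fun c hc => ?_) h1
      simp [hA.init_notMem c hc, hE c hc]
    by_cases h2 : dual c = (f.mapOriented E).forget
    · refine mem_iff_of_dual_eq_forget (fun c hc => ?_) h2
      simp [hA'.init_notMem c hc, hfE' c hc]
    · simp [hA.mem_iff c h1 hc, hA'.mem_iff c h2 hc]
  have hdisj : ∀ v ∈ A, v ∉ f.mapSet A := by
    intro v hv hv'
    refine hA.init_notMem a ha
      (hl.mem_of_forall (B := A ∩ f.mapSet A) (fun c => ?_) ⟨hv, hv'⟩ _).1
    by_cases h1 : dual c = E.forget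
    · refine mem_iff_of_dual_eq_forget (fun c hc => ?_) h1
      simp [hA.init_notMem c hc, hE c hc]
    by_cases h2 : dual c = (f.mapOriented E).forget
    · refine mem_iff_of_dual_eq_forget (fun c hc => ?_) h2
      simp [hA'.init_notMem c hc, hfE' c hc]
    by_cases h3 : dual c = F.forget
    · refine mem_iff_of_dual_eq_forget (fun c hc => ?_) h3
      have : init c ∉ f.mapSet A := by
        by_cases h : F = f.mapOriented E
        · exact hA'.init_notMem c (hc.trans h)
        · exact (hmin' F hF h hFF.symm c hc).1
      simp [this, hA.term_notMem c hc]
    by_cases h4 : dual c = (f.mapOriented F).forget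
    · refine mem_iff_of_dual_eq_forget (fun c hc => ?_) h4
      have : init c ∉ A := by
        by_cases h : f.mapOriented F = E
        · exact hA.init_notMem c (hc.trans h)
        · exact (hmin _ hfF h hFF c hc).1
      simp [this, hA'.term_notMem c hc]
    · simp [hA.mem_iff c h1 h3, hA'.mem_iff c h2 h4]
  have hlA' : ∀ e, dual e = dual (f.map 1 l) → init e ∉ A := by
    intro e he h
    refine hdisj _ h (Automorphism.init_mem_mapSet.2 (hlA _ ?_).1)
    exact Automorphism.dual_symm_map_iff.2 he
  obtain ⟨T, hT⟩ := hf.exists_isRegion_map hl hlA hlA'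
  have hTA : ∀ e, init e ∈ A → dual e ≠ dual l → (init e ∈ T ↔ term e ∈ T) :=
    fun e he hne => hT.mem_iff e hne fun h => hlA' e h he
  have hTE : ∀ e, orientedDual e = E → (term e ∈ T ↔ term a ∈ T) := by
    intro e he
    refine iff_of_eq (term_eq_of_orientedDual_eq hX (· ∈ T) (fun e c he hc hce => ?_) he ha)
    subst he
    exact propext (hTA c (hce ▸ hA.term_mem e rfl) fun h => hlE (h ▸ hc))
  have hTF : ∀ e, orientedDual e = F → (init e ∈ T ↔ init b ∈ T) := by
    intro e he
    refine iff_of_eq (init_eq_of_orientedDual_eq hX (· ∈ T) (fun e c he hc hce => ?_) he hb)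
    subst he
    exact propext (hTA c (hce ▸ hA.init_mem e rfl) fun h => hlF (h ▸ hc))
  have hlE' : dual l ≠ E.forget := by
    subst ha
    exact fun h => hA.init_notMem a rfl (hlA a h.symm).1
  have hlF' : dual l ≠ F.forget := by
    subst hb
    exact fun h => hA.term_notMem b rfl (hlA b h.symm).2
  -- neither orientation of the nonseparating hyperplane has the intersection numbers of `E`
  have hOint : ∀ k, dual k = dual l → intersection (orientedDual k) ≠ intersection E := by
    intro k hk h
    refine (hmin _ h ?_ ?_ k rfl).1 (hlA k hk).1
    · exact fun h' => hlE' (hk.symm.trans (congrArg OrientedHyperplane.forget h'))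
    · exact fun h' => hlF' (hk.symm.trans (congrArg OrientedHyperplane.forget h'))
  have hinner : ∀ e, dual e ≠ dual l → dual e ≠ E.forget → dual e ≠ F.forget →
      (init e ∈ A ∩ T ↔ term e ∈ A ∩ T) := by
    intro e h1 h2 h3
    have h4 := hA.mem_iff e h2 h3
    by_cases h5 : init e ∈ A
    · simp [h5, h4.1 h5, hTA e h5 h1]
    · simp [h5, mt h4.2 h5]
  by_cases hab : term a ∈ T ↔ init b ∈ T
  · -- `A ∩ T`, extended by a constant outside of `A`, exhibits the hyperplane as separating
    have key := hl {v | (v ∈ A → v ∈ T) ∧ (v ∉ A → term a ∈ T)} (fun e he => ?_) (term l)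
      (by simp [hlA l rfl, hT.term_mem l rfl]) (init l)
    · exact hT.init_notMem l rfl (key.1 (hlA l rfl).1)
    by_cases h1 : dual e = E.forget
    · refine mem_iff_of_dual_eq_forget (fun e he => ?_) h1
      simp [hA.init_notMem e he, hA.term_mem e he, hTE e he]
    by_cases h2 : dual e = F.forget
    · refine mem_iff_of_dual_eq_forget (fun e he => ?_) h2
      simp [hA.init_mem e he, hA.term_notMem e he, hTF e he, hab]
    · have h3 := hA.mem_iff e h1 h2
      by_cases h4 : init e ∈ A
      · simp [h4, h3.1 h4, hTA e h4 he]
      · simp [h4, mt h3.2 h4]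
  by_cases haT : term a ∈ T
  · -- `E` and the nonseparating hyperplane enter `A ∩ T`
    have hbT : init b ∉ T := fun h => hab ⟨fun _ => h, fun _ => haT⟩
    refine hOint (rev l) (dual_rev l) (IsRegion.intersection_eq hX (A := A ∩ T) ?_
      ⟨fun e he => ?_, fun e he => ?_, fun e he => ?_, fun e he => ?_, fun e h1 h2 => ?_⟩).symm
    · rw [forget_orientedDual, dual_rev]
      exact hlE'.symm
    · simp [hA.init_notMem e he]
    · simp [hA.term_mem e he, hTE e he, haT]
    · have he' : orientedDual (rev e) = orientedDual l := (orientedDual_rev_comm he.symm).symm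
      rw [← term_rev]
      exact ⟨(hlA _ (dual_eq_of_orientedDual_eq he')).2, hT.term_mem _ he'⟩
    · have he' : orientedDual (rev e) = orientedDual l := (orientedDual_rev_comm he.symm).symm
      rw [← init_rev]
      exact fun h => hT.init_notMem _ he' h.2
    · rw [forget_orientedDual, dual_rev] at h2
      by_cases h3 : dual e = F.forget
      · refine mem_iff_of_dual_eq_forget (fun e he => ?_) h3
        simp [hA.term_notMem e he, hTF e he, hbT]
      · exact hinner e h2 h1 h3
  · -- the nonseparating hyperplane enters `A ∩ T`, and `F` leaves it
    have hbT : init b ∈ T := by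
      by_contra h
      exact hab ⟨fun h' => absurd h' haT, fun h' => absurd h' h⟩
    refine hOint l rfl ((IsRegion.intersection_eq hX (A := A ∩ T) (E := orientedDual l) hlF'
      ⟨fun e he => ?_, fun e he => ?_, fun e he => ?_, fun e he => ?_, fun e h1 h2 => ?_⟩).trans hF)
    · simp [hT.init_notMem e he]
    · exact ⟨(hlA e (dual_eq_of_orientedDual_eq he)).2, hT.term_mem e he⟩
    · simp [hA.init_mem e he, hTF e he, hbT]
    · simp [hA.term_notMem e he]
    · by_cases h3 : dual e = E.forget
      · refine mem_iff_of_dual_eq_forget (fun e he => ?_) h3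
        simp [hA.init_notMem e he, hTE e he, haT]
      · exact hinner e h1 h3 h2

/-- `f` fixes every hyperplane. -/
theorem mapHyperplane_eq (hf : CombinatorialHypotheses f) (K : X.Hyperplane) :
    f.mapHyperplane K = K := by
  obtain ⟨a, rfl⟩ := Quot.exists_rep K
  change f.mapHyperplane (orientedDual a).forget = (orientedDual a).forget
  rw [← Automorphism.forget_mapOriented]
  by_cases h0 : intersection (orientedDual a) = 0
  · exact (hf.forget_mapOriented_of_intersection_eq_zero h0).symm
  · rw [hf.mapOriented_eq_of_intersection_ne_zero h0]

end CombinatorialHypotheses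

end CubeComplex

theorem mainTheorem6 (X : CubeComplex) (hcompact : X.IsCompactComplex) (hspecial : X.IsSpecial)
    (f : X.Automorphism)
    (h1 : ∀ E₁ E₂ : X.OrientedHyperplane, E₁.forget ≠ E₂.forget →
      (E₁.forget.carrier ∩ E₂.forget.carrier).Nonempty →
      ∃ α : X.H1, CubeComplex.intersection E₁ α ≠ CubeComplex.intersection E₂ α)
    (h2 : ∀ K₁ K₂ : X.Hyperplane, K₁.carrier ∩ K₂.carrier = ∅ →
      CubeComplex.Separates (K₁.carrier ∪ K₂.carrier) →
      ∀ p ∈ (K₁.carrier ∪ K₂.carrier)ᶜ, ∃ L : X.Hyperplane,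
        ¬ CubeComplex.Separates L.carrier ∧
        L.carrier ⊆ connectedComponentIn (K₁.carrier ∪ K₂.carrier)ᶜ p ∧
        L.carrier ∩ K₁.carrier = ∅ ∧ L.carrier ∩ K₂.carrier = ∅)
    (h3 : (∀ K : X.Hyperplane, f.mapHyperplane K = K) →
      f = CubeComplex.Automorphism.refl X)
    (hf : f.mapH1 = LinearMap.id) :
    f = CubeComplex.Automorphism.refl X := by
  have hdisj : ∀ E F : X.OrientedHyperplane,
      CubeComplex.intersection E = CubeComplex.intersection F →
      ¬ CubeComplex.Crosses E.forget F.forget := by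
    intro E F h hc
    obtain ⟨α, hα⟩ := h1 E F hc.1 hc.2
    exact hα (by rw [h])
  refine h3 (CubeComplex.CombinatorialHypotheses.mapHyperplane_eq
    ⟨hspecial, ?_, CubeComplex.Automorphism.intersection_mapOriented hf, hdisj, ?_⟩)
  · have : Finite (Σ n : ℕ, X.Cube n) := hcompact
    exact Finite.of_injective (fun v => (⟨0, v⟩ : Σ n : ℕ, X.Cube n)) sigma_mk_injective
  · intro E F hne hEF A hA v hv w hw
    obtain ⟨L, hL, hLA, hLE, hLF⟩ := h2 E.forget F.forget
      (Set.not_nonempty_iff_eq_empty.1 fun h => hdisj E F hEF ⟨hne, h⟩)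
      (CubeComplex.separates_of_closedOff hA hv hw) (CubeComplex.vertexPoint v)
      (CubeComplex.vertexPoint_mem_compl v _ _)
    obtain ⟨l, rfl⟩ := Quot.exists_rep L
    change ¬ CubeComplex.Separates (CubeComplex.dual l).carrier at hL
    refine ⟨l, fun W hW v hv w => CubeComplex.mem_of_not_separates hL hW hv w,
      fun e he => CubeComplex.endpoints_mem_of_carrier_subset hA hv hLA he,
      fun h => ?_, fun h => ?_⟩
    · exact Set.not_nonempty_iff_eq_empty.2 hLE (Set.inter_comm _ _ ▸ h.2)
    · exact Set.not_nonempty_iff_eq_empty.2 hLF (Set.inter_comm _ _ ▸ h.2)
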